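/- Consider maximum $k$-set coverage in the streaming-set model. A stream presents sets $S_1,\dots,S_m\subseteq[n]$ one after the other, each as its ID $i$ followed by the list of its elements (without repetition, in arbitrary order); the task is to output the IDs of $k$ sets whose union is as large as possible. Let $\mathrm{OPT}$ be the maximum of $|\bigcup_{i\in I}S_i|$ over all $I\subseteq[m]$ with $|I|=k$. A single-pass randomized streaming algorithm reads the items of the stream (IDs and elements) once, in order. Its memory is a bit string: initially, and then at each item, the new memory is computed from the parameters, the old memory, the current item and a finite number of fresh random bits, and after the last item the output is computed from the memory. These computations are given by computable functions, the same for all values of the parameters, and nothing but the memory is carried from one item to the next. The space is the largest number of bits in the memory, at any time and for any outcome of the random bits. **Theorem.** For every constant $a\in\mathbb N$ there are a single-pass randomized streaming algorithm and constants $C>0$, $c\in\mathbb N$ such that the following holds for all integers $n\ge1$, $1\le k\le m$, and all real $0<\varepsilon<1$. When the algorithm is given $n$, $m$, $k$ and the accuracy parameter $\lceil 1/\varepsilon\rceil$, then on the stream of any sets $S_1,\dots,S_m\subseteq[n]$ it uses at most $$C\,\varepsilon^{-2}\,m\,\bigl(\log(mn+2)\bigr)^{c}$$ bits of space, i.e.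 $\tilde O(\varepsilon^{-2}m)$, and with probability at least $1-(mn)^{-a}$ it outputs the IDs of exactly $k$ different sets $S_i$, $i\in I$, with $$\Bigl|\bigcup_{i\in I}S_i\Bigr|\ \ge\ \Bigl(1-\frac1e-\varepsilon\Bigr)\,\mathrm{OPT}.$$ -/

import Mathlib

open scoped ENNReal

namespace SetStream

/-! ### The maximum `k`-set coverage problem -/

/-- The number of elements covered by the sets with IDs in `I`. The `i`-th set is given by the list
`S i` of its elements, in the order in which the stream presents them. -/
def coverage {n m : ℕ} (S : Fin m → List (Fin n)) (I : Finset (Fin m)) : ℕ :=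
  (I.biUnion fun i => (S i).toFinset).card

/-- The largest number of elements covered by `k` of the sets. -/
def opt {n m : ℕ} (S : Fin m → List (Fin n)) (k : ℕ) : ℕ :=
  ((Finset.univ : Finset (Fin m)).powersetCard k).sup (coverage S)

/-! ### The streaming-set model -/

/-- An item of the stream: `Sum.inl i` announces the set with ID `i`, and `Sum.inr e` is an element
of the set announced last. -/
abbrev Item : Type := ℕ ⊕ ℕ

/-- The stream of a set system: the sets arrive one after the other, each as its ID followed by the
list of its elements. -/
def stream {n m : ℕ} (S : Fin m → List (Fin n)) : List Item :=
  (List.finRange m).flatMap fun i : Fin m =>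
    Sum.inl i.val :: (S i).map fun e : Fin n => Sum.inr e.val

/-- The parameters known in advance, `(n, m, k, q)`: the size of the universe, the number of sets,
the number of sets to be chosen, and the accuracy, `1 / q`. -/
abbrev Params : Type := ℕ × ℕ × ℕ × ℕ

/-- A single-pass randomized streaming algorithm. Its memory is a bit string. At the start, and at
every item of the stream, it receives `coins p` fresh random bits and computes its new memory from
the parameters, the old memory, the item and these bits; nothing else is carried over, so random
bits that are needed again have to be kept in memory. When the stream has ended, the output, a list
of IDs, is computed from the memory. One algorithm serves all values of the parameters. -/
structure StreamAlg where
  coins : Params → ℕ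
  init : Params × List Bool → List Bool
  step : Params × List Bool × Item × List Bool → List Bool
  output : Params × List Bool → List ℕ
  computable_coins : Computable coins
  computable_init : Computable init
  computable_step : Computable step
  computable_output : Computable output

/-- The distribution of `r` independent fair coins. -/
noncomputable def fairCoins (r : ℕ) : PMF (List Bool) :=
  (PMF.uniformOfFintype (Fin r → Bool)).map List.ofFn

namespace StreamAlg

/-- The distribution of the memory before the first item. -/
noncomputable def start (A : StreamAlg) (p : Params) : PMF (List Bool) :=
  (fairCoins (A.coins p)).map fun r => A.init (p, r)

/-- The distribution of the memory after the items in the list have been read, in this order. -/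
noncomputable def memory (A : StreamAlg) (p : Params) (items : List Item) : PMF (List Bool) :=
  items.foldl
    (fun μ x => μ.bind fun w => (fairCoins (A.coins p)).map fun r => A.step (p, w, x, r))
    (A.start p)

/-- On the given stream, the memory never holds more than `s` bits, whatever the coins are. -/
def UsesSpaceAtMost (A : StreamAlg) (p : Params) (items : List Item) (s : ℝ) : Prop :=
  ∀ l : List Item, l <+: items → ∀ w ∈ (A.memory p l).support, (w.length : ℝ) ≤ s

/-- The distribution of the output on the given stream. -/
noncomputable def result (A : StreamAlg) (p : Params) (items : List Item) : PMF (List ℕ) :=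
  (A.memory p items).map fun w => A.output (p, w)

end StreamAlg

/-- The list `out` consists of the IDs of exactly `k` different sets, and these cover at least
`α` times as many elements as any `k` sets do. -/
def IsApproxSolution {n m : ℕ} (S : Fin m → List (Fin n)) (k : ℕ) (α : ℝ) (out : List ℕ) : Prop :=
  ∃ I : Finset (Fin m), I.card = k ∧ out.toFinset = I.map Fin.valEmbedding ∧
    α * (opt S k : ℝ) ≤ (coverage S I : ℝ)

end SetStream

/-!
# Single-pass maximum coverage in space `Õ(m / ε ^ 2)`

**Sampling and sketching.** A random sample of the universe, of rate `p`, preserves the coverage of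
all families of `k` sets up to an error `ε * p * OPT`, as soon as `p * OPT` is of the order
`k * log (m * n) / ε ^ 2` (`card_badHashes_mul_le`: Chernoff's bound and a union bound over the
families). So let `B` be of the order `log (m * n) / ε ^ 2`. While the stream passes, a sampled element
of the current set is stored unless it belongs to the stored part of a set for which at least `B`
elements are stored (`sketchStep`). These full sets have disjoint stored parts, each of size at least
`B ≥ OPT' / k`, where `OPT'` is the optimum of the sample, so choosing them is as good as steps of the
greedy algorithm. Everything else that greedy needs to continue is known, since the sets that are not
full are stored up to elements of the full ones. Hence the best `k` sets of the sketch are a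
`1 - (1 - 1 / k) ^ k` approximation for the sample as long as `OPT' ≤ k * B`
(`greedy_le_maxCover`, `le_maxCover_sketch`). A sketch of more than `(m + k) * B` pairs proves that
`OPT' ≥ k * B` and need not grow any more. As `OPT` is unknown, sketches for all the rates
`1, 1 / 2, 1 / 4, …` are kept. The first one whose best `k` sets cover fewer than `k * B / 2` sampled
elements has a rate that is right (`le_coverage_selectSets`).

**Few random bits.** The hash function that defines the samples is too large to be stored. But there is
a family of `(m * n) ^ O(a)` hash functions such that, for every input, all but a fraction
`(m * n) ^ (-a)` of them are good (`exists_family_few_bad`), and an index into this family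
is short. The states of the resulting machine are then few enough to be encoded
by bit strings of the required length (`exists_machine`).

**Uniformity.** The family of hash functions, and with it the machine, is only known to exist for each
value of the parameters. In the model a computation need only be computable. So the algorithm searches
all finite tables for a machine that passes a test on every input of the given size
(`exists_computable_choice`). The test `TableGood` is primitive recursive
(`primrecRel_tableGood`); since `1 / e` is irrational, it compares with the rational
bound `1 - (1 - 1 / k) ^ k - 1 / q`, where `q = ⌈1 / ε⌉`.
-/

namespace SetStream

/-! ### Covering by a family of finite sets -/

section Cover

variable {α β : Type*} [DecidableEq β]

/-- The largest number of elements covered by `k` sets of the family `T`. -/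
def maxCover [Fintype α] (T : α → Finset β) (k : ℕ) : ℕ :=
  ((Finset.univ : Finset α).powersetCard k).sup fun I => (I.biUnion T).card

theorem card_biUnion_le_maxCover [Fintype α] (T : α → Finset β) {k : ℕ} {I : Finset α}
    (hI : I.card = k) : (I.biUnion T).card ≤ maxCover T k :=
  Finset.le_sup (f := fun I : Finset α => (I.biUnion T).card)
    (Finset.mem_powersetCard.2 ⟨Finset.subset_univ _, hI⟩)

theorem exists_card_biUnion_eq_maxCover [Fintype α] (T : α → Finset β) {k : ℕ}
    (hk : k ≤ Fintype.card α) :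
    ∃ I : Finset α, I.card = k ∧ (I.biUnion T).card = maxCover T k := by
  have hne : ((Finset.univ : Finset α).powersetCard k).Nonempty := by
    rw [Finset.powersetCard_nonempty]
    simpa using hk
  obtain ⟨I, hI, h⟩ := Finset.exists_mem_eq_sup _ hne fun I : Finset α => (I.biUnion T).card
  exact ⟨I, (Finset.mem_powersetCard.1 hI).2, h.symm⟩

theorem maxCover_mono [Fintype α] {T T' : α → Finset β} (h : ∀ i, T i ⊆ T' i) (k : ℕ) :
    maxCover T k ≤ maxCover T' k :=
  Finset.sup_mono_fun fun _ _ =>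
    Finset.card_le_card (Finset.biUnion_mono fun i _ => h i)

/-- Fewer than `k` sets can be completed to `k` sets, which cover at least as much. -/
theorem card_biUnion_le_maxCover_of_card_le [Fintype α] (T : α → Finset β) {k : ℕ}
    (hk : k ≤ Fintype.card α) {I : Finset α} (hI : I.card ≤ k) :
    (I.biUnion T).card ≤ maxCover T k := by
  obtain ⟨J, hIJ, hJ⟩ := Finset.exists_superset_card_eq hI hk
  exact (Finset.card_le_card (Finset.biUnion_subset_biUnion_of_subset_left T hIJ)).trans
    (card_biUnion_le_maxCover T hJ)

theorem mul_card_le_card_biUnion {T : α → Finset β} {B : ℕ} {F : Finset α}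
    (hfull : ∀ i ∈ F, B ≤ (T i).card) (hdisj : (F : Set α).PairwiseDisjoint T) :
    F.card * B ≤ (F.biUnion T).card := by
  rw [Finset.card_biUnion hdisj, ← smul_eq_mul]
  exact Finset.card_nsmul_le_sum _ _ _ hfull

/-- Enough disjoint sets of size `B` are themselves a cover of size `k * B`. -/
theorem mul_le_maxCover_of_le_card [Fintype α] {T : α → Finset β} {B k : ℕ} {F : Finset α}
    (hfull : ∀ i ∈ F, B ≤ (T i).card) (hdisj : (F : Set α).PairwiseDisjoint T)
    (hk : k ≤ F.card) : k * B ≤ maxCover T k := by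
  obtain ⟨I, hIF, hI⟩ := Finset.exists_subset_card_eq hk
  have h := mul_card_le_card_biUnion (T := T) (B := B) (F := I) (fun i hi => hfull i (hIF hi))
    (hdisj.subset (by exact_mod_cast hIF))
  rw [hI] at h
  exact h.trans (card_biUnion_le_maxCover T hI)

/-- One step of the greedy algorithm: unless `V` elements are covered already, one of the sets of a
cover of size `V` by `k` sets gains at least a `1 / k` fraction of what is missing. -/
theorem exists_greedy_step [Fintype α] [DecidableEq α] {T S : α → Finset β} {k : ℕ} (hk : 0 < k)
    (hkα : k ≤ Fintype.card α) {I : Finset α} (hI : I.card < k)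
    (hS : ∀ i, S i ⊆ T i ∪ I.biUnion T) {V : ℝ} (hV : V ≤ maxCover S k) {r : ℝ} (hr : 0 ≤ r)
    (hIV : V - (I.biUnion T).card ≤ r) :
    ∃ J : Finset α, I ⊆ J ∧ J.card = I.card + 1 ∧
      V - (J.biUnion T).card ≤ (1 - 1 / (k : ℝ)) * r := by
  set U := I.biUnion T with hU
  have hk' : (0 : ℝ) < k := by exact_mod_cast hk
  have hk1 : (1 : ℝ) ≤ k := by exact_mod_cast hk
  have hfac : 0 ≤ 1 - 1 / (k : ℝ) := by
    rw [sub_nonneg, div_le_one hk']; exact hk1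
  rcases le_or_gt V U.card with hle | hgt
  · obtain ⟨J, hIJ, hJ⟩ := Finset.exists_superset_card_eq (s := I) (n := I.card + 1)
      (Nat.le_succ _) (by omega)
    refine ⟨J, hIJ, hJ, ?_⟩
    have h1 : U.card ≤ (J.biUnion T).card :=
      Finset.card_le_card (Finset.biUnion_subset_biUnion_of_subset_left T hIJ)
    have h2 : (U.card : ℝ) ≤ (J.biUnion T).card := by exact_mod_cast h1
    have := mul_nonneg hfac hr
    linarith
  · obtain ⟨O, hO, hOS⟩ := exists_card_biUnion_eq_maxCover S hkα
    have hsub : O.biUnion S ⊆ U ∪ O.biUnion fun i => T i \ U := by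
      intro e he
      obtain ⟨i, hi, hei⟩ := Finset.mem_biUnion.1 he
      by_cases heU : e ∈ U
      · exact Finset.mem_union_left _ heU
      · refine Finset.mem_union_right _ (Finset.mem_biUnion.2 ⟨i, hi, ?_⟩)
        rcases Finset.mem_union.1 (hS i hei) with h | h
        · exact Finset.mem_sdiff.2 ⟨h, heU⟩
        · exact absurd h heU
    have hcard : (maxCover S k : ℝ) ≤ U.card + ∑ i ∈ O, ((T i \ U).card : ℝ) := by
      rw [← hOS]
      have := (Finset.card_le_card hsub).trans
        ((Finset.card_union_le _ _).trans (Nat.add_le_add_left Finset.card_biUnion_le _))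
      exact_mod_cast this
    obtain ⟨i, hiO, hi⟩ : ∃ i ∈ O, (V - U.card) / k ≤ ((T i \ U).card : ℝ) := by
      by_contra! hcon
      have hne : O.Nonempty := by rw [← Finset.card_pos, hO]; exact hk
      have := Finset.sum_lt_sum_of_nonempty hne hcon
      rw [Finset.sum_const, hO, nsmul_eq_mul, mul_div_cancel₀ _ hk'.ne'] at this
      linarith
    have hiI : i ∉ I := by
      intro hiI
      have h0 : T i \ U = ∅ := Finset.sdiff_eq_empty_iff_subset.2
        (Finset.subset_biUnion_of_mem T hiI)
      rw [h0, Finset.card_empty, Nat.cast_zero] at hi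
      have : 0 < (V - U.card) / k := div_pos (by linarith) hk'
      linarith
    refine ⟨insert i I, Finset.subset_insert _ _, Finset.card_insert_of_notMem hiI, ?_⟩
    have hc : ((insert i I).biUnion T).card = (T i \ U).card + U.card := by
      rw [Finset.biUnion_insert, ← hU, ← Finset.sdiff_union_self_eq_union,
        Finset.card_union_of_disjoint Finset.sdiff_disjoint]
    rw [hc]
    push_cast
    have h3 : (1 - 1 / (k : ℝ)) * (V - U.card) ≤ (1 - 1 / (k : ℝ)) * r :=
      mul_le_mul_of_nonneg_left hIV hfac
    have h4 : (1 - 1 / (k : ℝ)) * (V - U.card) = (V - U.card) - (V - U.card) / k := by ring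
    linarith

/-- Disjoint sets `T i`, `i ∈ F`, of size at least `B ≥ V / k` are as good as the first steps of the
greedy algorithm, which can therefore be continued from them. Only the part of `S i` outside
the union of these sets needs to be known. -/
theorem greedy_le_maxCover [Fintype α] [DecidableEq α] {T S : α → Finset β} {k B : ℕ} (hk : 0 < k)
    (hkα : k ≤ Fintype.card α) {F : Finset α} (hF : F.card ≤ k)
    (hfull : ∀ i ∈ F, B ≤ (T i).card) (hdisj : (F : Set α).PairwiseDisjoint T)
    (hS : ∀ i, S i ⊆ T i ∪ F.biUnion T) {V : ℝ} (hV0 : 0 ≤ V) (hV : V ≤ maxCover S k)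
    (hVB : V ≤ k * B) :
    (1 - (1 - 1 / (k : ℝ)) ^ k) * V ≤ maxCover T k := by
  have hk' : (0 : ℝ) < k := by exact_mod_cast hk
  have hk1 : (1 : ℝ) ≤ k := by exact_mod_cast hk
  have hfac : 0 ≤ 1 - 1 / (k : ℝ) := by
    rw [sub_nonneg, div_le_one hk']; exact hk1
  have key : ∀ j, F.card ≤ j → j ≤ k → ∃ I : Finset α, F ⊆ I ∧ I.card = j ∧
      V - (I.biUnion T).card ≤ (1 - 1 / (k : ℝ)) ^ j * V := by
    intro j hj
    induction j, hj using Nat.le_induction with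
    | base =>
      intro _
      refine ⟨F, subset_rfl, rfl, ?_⟩
      have h1 : ((F.card * B : ℕ) : ℝ) ≤ (F.biUnion T).card := by
        exact_mod_cast mul_card_le_card_biUnion hfull hdisj
      push_cast at h1
      have h2 : 1 + (F.card : ℝ) * (-(1 / (k : ℝ))) ≤ (1 + -(1 / (k : ℝ))) ^ F.card := by
        apply one_add_mul_le_pow
        have : 1 / (k : ℝ) ≤ 1 := by rw [div_le_one hk']; exact hk1
        linarith
      have h3 := mul_le_mul_of_nonneg_right h2 hV0
      rw [← sub_eq_add_neg] at h3
      have h4 : (F.card : ℝ) * (V / k) ≤ F.card * B :=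
        mul_le_mul_of_nonneg_left (by rw [div_le_iff₀ hk']; linarith) (Nat.cast_nonneg _)
      have h5 : (1 + (F.card : ℝ) * -(1 / (k : ℝ))) * V = V - F.card * (V / k) := by ring
      linarith
    | succ j hj ih =>
      intro hjk
      obtain ⟨I, hFI, hI, hIV⟩ := ih (by omega)
      obtain ⟨J, hIJ, hJ, hJV⟩ := exists_greedy_step (T := T) (S := S) hk hkα (I := I) (by omega)
        (fun i => (hS i).trans (Finset.union_subset_union_right
          (Finset.biUnion_subset_biUnion_of_subset_left T hFI))) hV
        (mul_nonneg (pow_nonneg hfac j) hV0) hIV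
      refine ⟨J, hFI.trans hIJ, by omega, hJV.trans_eq ?_⟩
      ring
  obtain ⟨I, -, hI, hIV⟩ := key k hF le_rfl
  have h1 : ((I.biUnion T).card : ℝ) ≤ maxCover T k := by
    exact_mod_cast card_biUnion_le_maxCover T hI
  linarith

end Cover

/-! ### The sketch of one sampled instance -/

section Sketch

variable {α β : Type*} [DecidableEq α] [DecidableEq β]

/-- The elements that the sketch `X`, a set of pairs of a set ID and an element, holds for the
set `i`. -/
def kept (X : Finset (α × β)) (i : α) : Finset β :=
  (X.filter fun x => x.1 = i).image Prod.snd

@[simp]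
theorem mem_kept {X : Finset (α × β)} {i : α} {e : β} : e ∈ kept X i ↔ (i, e) ∈ X := by
  simp [kept]

theorem kept_mono {X Y : Finset (α × β)} (h : X ⊆ Y) (i : α) : kept X i ⊆ kept Y i := by
  intro e he
  rw [mem_kept] at he ⊢
  exact h he

theorem card_kept (X : Finset (α × β)) (i : α) :
    (kept X i).card = (X.filter fun x => x.1 = i).card := by
  refine Finset.card_image_of_injOn ?_
  rintro ⟨a, b⟩ ha ⟨c, d⟩ hc (h : b = d)
  have h1 : a = i := by simpa using (Finset.mem_filter.1 (Finset.mem_coe.1 ha)).2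
  have h2 : c = i := by simpa using (Finset.mem_filter.1 (Finset.mem_coe.1 hc)).2
  rw [h1, h2, h]

theorem sum_card_kept [Fintype α] (X : Finset (α × β)) : ∑ i, (kept X i).card = X.card := by
  simp_rw [card_kept]
  exact (Finset.card_eq_sum_card_fiberwise fun x _ => Finset.mem_coe.2 (Finset.mem_univ x.1)).symm

/-- `e` is held for a set for which at least `B` elements are held. Such a set is regarded as chosen,
so `e` is regarded as covered. -/
def IsCovered (B : ℕ) (X : Finset (α × β)) (e : β) : Prop :=
  ∃ i, B ≤ (kept X i).card ∧ (i, e) ∈ X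

theorem IsCovered.mono {B : ℕ} {X Y : Finset (α × β)} (h : X ⊆ Y) {e : β}
    (he : IsCovered B X e) : IsCovered B Y e := by
  obtain ⟨i, hi, hie⟩ := he
  exact ⟨i, hi.trans (Finset.card_le_card (kept_mono h i)), h hie⟩

open Classical in
/-- The sketch after an element `x.2` of the set `x.1`: the pair is stored if the element is sampled
(belongs to `A`) and is not covered. A sketch with more than `M` pairs is left alone. -/
noncomputable def sketchStep (A : Finset β) (B M : ℕ) (X : Finset (α × β)) (x : α × β) :
    Finset (α × β) :=
  if x.2 ∈ A ∧ X.card ≤ M ∧ ¬ IsCovered B X x.2 then insert x X else X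

theorem subset_sketchStep (A : Finset β) (B M : ℕ) (X : Finset (α × β)) (x : α × β) :
    X ⊆ sketchStep A B M X x := by
  unfold sketchStep
  split_ifs
  · exact Finset.subset_insert _ _
  · exact subset_rfl

theorem card_sketchStep_le (A : Finset β) (B M : ℕ) {X : Finset (α × β)} (hX : X.card ≤ M + 1)
    (x : α × β) : (sketchStep A B M X x).card ≤ M + 1 := by
  unfold sketchStep
  split_ifs with h
  · exact (Finset.card_insert_le _ _).trans (Nat.succ_le_succ h.2.1)
  · exact hX

/-- The sketch of a list of pairs of a set ID and an element. -/
noncomputable def sketch (A : Finset β) (B M : ℕ) (l : List (α × β)) : Finset (α × β) :=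
  l.foldl (sketchStep A B M) ∅

theorem sketch_append_singleton (A : Finset β) (B M : ℕ) (l : List (α × β)) (x : α × β) :
    sketch A B M (l ++ [x]) = sketchStep A B M (sketch A B M l) x := by
  simp [sketch]

theorem mem_of_mem_sketch {A : Finset β} {B M : ℕ} {l : List (α × β)} {x : α × β}
    (hx : x ∈ sketch A B M l) : x ∈ l ∧ x.2 ∈ A := by
  induction l using List.reverseRecOn with
  | nil => simp [sketch] at hx
  | append_singleton l y ih =>
    rw [sketch_append_singleton, sketchStep] at hx
    split_ifs at hx with h
    · rcases Finset.mem_insert.1 hx with rfl | hx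
      · exact ⟨by simp, h.1⟩
      · exact ⟨List.mem_append_left _ (ih hx).1, (ih hx).2⟩
    · exact ⟨List.mem_append_left _ (ih hx).1, (ih hx).2⟩

/-- As long as the sketch has not overflowed, every sampled element that has passed is stored for its
set or covered. -/
theorem mem_sketch_or_isCovered {A : Finset β} {B M : ℕ} {l : List (α × β)}
    (hM : (sketch A B M l).card ≤ M) {x : α × β} (hx : x ∈ l) (hxA : x.2 ∈ A) :
    x ∈ sketch A B M l ∨ IsCovered B (sketch A B M l) x.2 := by
  induction l using List.reverseRecOn with
  | nil => simp at hx
  | append_singleton l y ih =>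
    rw [sketch_append_singleton] at hM ⊢
    have hsub := subset_sketchStep A B M (sketch A B M l) y
    have hM' := (Finset.card_le_card hsub).trans hM
    rcases List.mem_append.1 hx with hxl | hxy
    · rcases ih hM' hxl with h | h
      · exact Or.inl (hsub h)
      · exact Or.inr (h.mono hsub)
    · obtain rfl : x = y := by simpa using hxy
      by_cases hc : IsCovered B (sketch A B M l) x.2
      · exact Or.inr (hc.mono hsub)
      · left
        rw [sketchStep, if_pos ⟨hxA, hM', hc⟩]
        exact Finset.mem_insert_self _ _

/-- Since the sets arrive one after the other, everything that is held for a later set is disjoint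
from what is held for an earlier set of size at least `B`. -/
theorem disjoint_kept_sketch {α : Type*} [LinearOrder α] {A : Finset β} {B M : ℕ}
    {l : List (α × β)} (hl : l.Pairwise fun x y => x.1 ≤ y.1) {i j : α} (hij : i < j)
    (hi : B ≤ (kept (sketch A B M l) i).card) :
    Disjoint (kept (sketch A B M l) i) (kept (sketch A B M l) j) := by
  induction l using List.reverseRecOn with
  | nil => simp [sketch, kept]
  | append_singleton l x ih =>
    rw [List.pairwise_append] at hl
    obtain ⟨hl, -, hlx⟩ := hl
    have hlx : ∀ y ∈ l, y.1 ≤ x.1 := fun y hy => hlx y hy x (by simp)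
    rw [sketch_append_singleton, sketchStep] at hi ⊢
    split_ifs at hi ⊢ with h
    swap
    · exact ih hl hi
    obtain ⟨-, -, hc⟩ := h
    obtain ⟨a, b⟩ := x
    rw [Finset.disjoint_left]
    intro e hei hej
    rw [mem_kept, Finset.mem_insert, Prod.mk.injEq] at hei hej
    have hlt : ∀ {c : α} {e : β}, (c, e) ∈ sketch A B M l → c ≤ a := fun hce =>
      hlx _ (mem_of_mem_sketch hce).1
    rcases hej with ⟨rfl, rfl⟩ | hej
    · -- The set `i` was complete before the new element, which is not covered by it.
      have hne : ∀ d, (i, d) ∈ insert (j, e) (sketch A B M l) → (i, d) ∈ sketch A B M l := by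
        intro d hd
        rcases Finset.mem_insert.1 hd with h | h
        · exact absurd (Prod.mk.inj h).1 hij.ne
        · exact h
      have hsub : kept (insert (j, e) (sketch A B M l)) i ⊆ kept (sketch A B M l) i := by
        intro d hd
        rw [mem_kept] at hd ⊢
        exact hne d hd
      rcases hei with ⟨rfl, -⟩ | hei
      · exact lt_irrefl _ hij
      · exact hc ⟨i, hi.trans (Finset.card_le_card hsub), hei⟩
    · have hia : i < a := hij.trans_le (hlt hej)
      rcases hei with ⟨rfl, -⟩ | hei
      · exact lt_irrefl _ hia
      · have hsub : kept (insert (a, b) (sketch A B M l)) i ⊆ kept (sketch A B M l) i := by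
          intro d hd
          rw [mem_kept] at hd ⊢
          rcases Finset.mem_insert.1 hd with h | h
          · exact absurd (Prod.mk.inj h).1 hia.ne
          · exact h
        exact Finset.disjoint_left.1 (ih hl (hi.trans (Finset.card_le_card hsub)))
          (mem_kept.2 hei) (mem_kept.2 hej)

end Sketch

/-- The part of the family `S` that lies in the sample `A`. -/
def sampled {α β : Type*} [DecidableEq β] (S : α → Finset β) (A : Finset β) (i : α) : Finset β :=
  S i ∩ A

/-- The list of the pairs of a set ID and an element of that set, in the order of the stream. -/
def streamPairs {n m : ℕ} (S : Fin m → List (Fin n)) : List (Fin m × Fin n) :=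
  (List.finRange m).flatMap fun i => (S i).map fun e => (i, e)

theorem mem_streamPairs {n m : ℕ} {S : Fin m → List (Fin n)} {x : Fin m × Fin n} :
    x ∈ streamPairs S ↔ x.2 ∈ S x.1 := by
  obtain ⟨i, e⟩ := x
  simp [streamPairs]

theorem pairwise_streamPairs {n m : ℕ} (S : Fin m → List (Fin n)) :
    (streamPairs S).Pairwise fun x y => x.1 ≤ y.1 := by
  unfold streamPairs
  rw [List.pairwise_flatMap]
  constructor
  · intro i _
    rw [List.pairwise_map]
    exact List.pairwise_of_forall fun _ _ => le_rfl
  · refine (List.pairwise_lt_finRange m).imp ?_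
    intro i j hij x hx y hy
    simp only [List.mem_map] at hx hy
    obtain ⟨_, _, rfl⟩ := hx
    obtain ⟨_, _, rfl⟩ := hy
    exact hij.le

section Level

variable {n m : ℕ} (S : Fin m → List (Fin n)) (A : Finset (Fin n)) (B k : ℕ)

theorem kept_sketch_subset (M : ℕ) (i : Fin m) :
    kept (sketch A B M (streamPairs S)) i ⊆ sampled (fun i => (S i).toFinset) A i := by
  intro e he
  have h := mem_of_mem_sketch (mem_kept.1 he)
  rw [mem_streamPairs] at h
  exact Finset.mem_inter.2 ⟨List.mem_toFinset.2 h.1, h.2⟩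

/-- The best `k` sets of the sketch cover at least `1 - (1 - 1 / k) ^ k` times as many elements as
the best `k` sets of the sampled instance, as far as this optimum does not exceed `k * B`. -/
theorem le_maxCover_sketch (hk : 0 < k) (hkm : k ≤ m) {V : ℝ} (hV0 : 0 ≤ V)
    (hV : V ≤ maxCover (sampled (fun i => (S i).toFinset) A) k) (hVB : V ≤ k * B) :
    (1 - (1 - 1 / (k : ℝ)) ^ k) * V ≤
      maxCover (kept (sketch A B ((m + k) * B) (streamPairs S))) k := by
  set X := sketch A B ((m + k) * B) (streamPairs S) with hX
  set F : Finset (Fin m) := Finset.univ.filter fun i => B ≤ (kept X i).card with hFdef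
  have hkm' : k ≤ Fintype.card (Fin m) := by simpa using hkm
  have hfull : ∀ i ∈ F, B ≤ (kept X i).card := fun i hi => (Finset.mem_filter.1 hi).2
  have hdisj : (F : Set (Fin m)).PairwiseDisjoint (kept X) := by
    intro i hi j hj hij
    rcases lt_or_gt_of_ne hij with h | h
    · exact disjoint_kept_sketch (pairwise_streamPairs S) h (hfull i hi)
    · exact (disjoint_kept_sketch (pairwise_streamPairs S) h (hfull j hj)).symm
  have hfac : 1 - (1 - 1 / (k : ℝ)) ^ k ≤ 1 := by
    have : (0 : ℝ) ≤ (1 - 1 / (k : ℝ)) ^ k := by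
      apply pow_nonneg
      rw [sub_nonneg, div_le_one (by exact_mod_cast hk)]
      exact_mod_cast hk
    linarith
  have hbig : k * B ≤ maxCover (kept X) k →
      (1 - (1 - 1 / (k : ℝ)) ^ k) * V ≤ maxCover (kept X) k := by
    intro h
    have h' : (k : ℝ) * B ≤ maxCover (kept X) k := by exact_mod_cast h
    have := mul_le_mul_of_nonneg_right hfac hV0
    linarith
  rcases le_total k F.card with hkF | hFk
  · exact hbig (mul_le_maxCover_of_le_card hfull hdisj hkF)
  rcases le_or_gt X.card ((m + k) * B) with hcard | hcard
  · refine greedy_le_maxCover hk hkm' hFk hfull hdisj (fun i e he => ?_) hV0 hV hVB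
    obtain ⟨heS, heA⟩ := Finset.mem_inter.1 he
    rcases mem_sketch_or_isCovered hcard (x := (i, e))
      (mem_streamPairs.2 (List.mem_toFinset.1 heS)) heA with h | ⟨j, hj, hje⟩
    · exact Finset.mem_union_left _ (mem_kept.2 h)
    · exact Finset.mem_union_right _ (Finset.mem_biUnion.2
        ⟨j, Finset.mem_filter.2 ⟨Finset.mem_univ _, hj⟩, mem_kept.2 hje⟩)
  · -- An overflowing sketch holds more than `k * B` elements for the sets of size at least `B`.
    apply hbig
    refine le_trans ?_ (card_biUnion_le_maxCover_of_card_le (kept X) hkm' hFk)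
    rw [Finset.card_biUnion hdisj]
    have h1 : ∑ i ∈ F, (kept X i).card +
        ∑ i ∈ Finset.univ.filter (fun i => ¬ B ≤ (kept X i).card), (kept X i).card = X.card := by
      rw [hFdef, Finset.sum_filter_add_sum_filter_not, sum_card_kept]
    have h2 : ∑ i ∈ Finset.univ.filter (fun i => ¬ B ≤ (kept X i).card), (kept X i).card
        ≤ m * B := by
      refine (Finset.sum_le_card_nsmul _ _ B fun i hi => ?_).trans ?_
      · exact (not_le.1 (Finset.mem_filter.1 hi).2).le
      · rw [smul_eq_mul]
        exact Nat.mul_le_mul_right _ ((Finset.card_le_univ _).trans (by simp))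
    rw [add_mul] at hcard
    omega

end Level

/-! ### Choosing the sampling rate -/

section Select

variable {n m : ℕ}

theorem opt_eq_maxCover (S : Fin m → List (Fin n)) (k : ℕ) :
    opt S k = maxCover (fun i => (S i).toFinset) k := rfl

open Classical in
/-- A choice of `k` sets that cover the most elements of the sketch `X`. -/
noncomputable def bestSets (X : Finset (Fin m × Fin n)) (k : ℕ) : Finset (Fin m) :=
  if h : ∃ I : Finset (Fin m), I.card = k ∧ (I.biUnion (kept X)).card = maxCover (kept X) k then
    h.choose else ∅

theorem bestSets_spec (X : Finset (Fin m × Fin n)) {k : ℕ} (hk : k ≤ m) :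
    (bestSets X k).card = k ∧ ((bestSets X k).biUnion (kept X)).card = maxCover (kept X) k := by
  have h := exists_card_biUnion_eq_maxCover (kept X) (k := k) (by simpa using hk)
  rw [bestSets, dif_pos h]
  exact h.choose_spec

open Classical in
/-- The sets that are best for the first (most densely sampled) of the given sketches whose best
`k` sets cover fewer than `k * B / 2` elements. -/
noncomputable def selectSets {N : ℕ} (B k : ℕ) (X : Fin N → Finset (Fin m × Fin n)) :
    Finset (Fin m) :=
  if h : ∃ i, ∃ hi : i < N, 2 * maxCover (kept (X ⟨i, hi⟩)) k < k * B then
    bestSets (X ⟨Nat.find h, (Nat.find_spec h).1⟩) k else ∅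

theorem selectSets_spec {N B k : ℕ} {X : Fin N → Finset (Fin m × Fin n)}
    (h : ∃ i, ∃ hi : i < N, 2 * maxCover (kept (X ⟨i, hi⟩)) k < k * B) :
    ∃ i, ∃ hi : i < N, selectSets B k X = bestSets (X ⟨i, hi⟩) k ∧
      2 * maxCover (kept (X ⟨i, hi⟩)) k < k * B ∧
      ∀ j, j < i → ∀ hj : j < N, ¬ 2 * maxCover (kept (X ⟨j, hj⟩)) k < k * B := by
  classical
  refine ⟨Nat.find h, (Nat.find_spec h).1, ?_, (Nat.find_spec h).2, fun j hj hjN hlt =>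
    Nat.find_min h hj ⟨hjN, hlt⟩⟩
  rw [selectSets, dif_pos h]

/-- In the sample `A` of rate `p`, all unions of `k` sets have about the expected size, with an error
that is a fraction `δ` of this size, or of `r` for smaller sizes. -/
def Concentrated (S : Fin m → Finset (Fin n)) (k : ℕ) (p δ r : ℝ) (A : Finset (Fin n)) : Prop :=
  ∀ I : Finset (Fin m), I.card = k →
    |((I.biUnion (sampled S A)).card : ℝ) - p * (I.biUnion S).card| ≤
      δ * max (p * (I.biUnion S).card) r

theorem one_sub_one_div_pow_le_half {k : ℕ} (hk : 0 < k) : (1 - 1 / (k : ℝ)) ^ k ≤ 1 / 2 := by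
  have h := Real.one_sub_div_pow_le_exp_neg (n := k) (t := 1) (by exact_mod_cast hk)
  refine h.trans ?_
  rw [Real.exp_neg, inv_eq_one_div]
  have := Real.add_one_le_exp (1 : ℝ)
  exact one_div_le_one_div_of_le (by norm_num) (by linarith)

theorem one_sub_one_div_pow_nonneg {k : ℕ} (hk : 0 < k) : (0 : ℝ) ≤ (1 - 1 / (k : ℝ)) ^ k := by
  apply pow_nonneg
  rw [sub_nonneg, div_le_one (by exact_mod_cast hk)]
  exact_mod_cast hk

/-- If some `k` sets cover at least `R / 2` elements of the sample, then its rate is such that `R / 8`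
elements or more of the best cover are expected in it. -/
theorem le_maxCover_of_concentrated {S : Fin m → Finset (Fin n)} {k : ℕ} (hkm : k ≤ m)
    {p δ R : ℝ} {A : Finset (Fin n)} (hδ : δ ≤ 1) (hR : 0 ≤ R) (hp : 0 ≤ p)
    (hA : Concentrated S k p δ (R / 16) A) (h : R / 2 ≤ maxCover (sampled S A) k) :
    R / 8 ≤ p * maxCover S k := by
  obtain ⟨I, hI, hIc⟩ := exists_card_biUnion_eq_maxCover (sampled S A) (k := k) (by simpa using hkm)
  have h1 := hA I hI
  rw [hIc] at h1
  set x : ℝ := p * (I.biUnion S).card with hx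
  have hx0 : 0 ≤ x := by positivity
  have h2 : δ * max x (R / 16) ≤ x + R / 16 := by
    calc δ * max x (R / 16) ≤ 1 * max x (R / 16) :=
          mul_le_mul_of_nonneg_right hδ (le_max_of_le_left hx0)
      _ ≤ x + R / 16 := by
          rw [one_mul]; exact max_le (by linarith) (by linarith)
  have h3 := (abs_le.1 h1).2
  have h4 : x ≤ p * maxCover S k :=
    mul_le_mul_of_nonneg_left (by exact_mod_cast card_biUnion_le_maxCover S hI) hp
  linarith

variable (S : Fin m → List (Fin n))

/-- The sets selected from the sketches at the sampling rates `1, 1 / 2, 1 / 4, …` are good, if all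
samples are concentrated. A sketch that is passed over has a large optimum. At the first sketch that
is not passed over the optimum is thus still large enough to be estimated, and small enough for
the sketch to be faithful. -/
theorem le_coverage_selectSets {k B L : ℕ} (hk : 0 < k) (hkm : k ≤ m) (hn : n ≤ 2 ^ L)
    (hB : 16 ≤ B) {δ : ℝ} (hδ0 : 0 ≤ δ) (hδ : δ ≤ 1) (A : Fin (L + 1) → Finset (Fin n))
    (hA0 : A 0 = Finset.univ)
    (hA : ∀ i : Fin (L + 1), Concentrated (fun i => (S i).toFinset) k ((1 / 2 : ℝ) ^ (i : ℕ)) δ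
      ((k : ℝ) * B / 16) (A i))
    (X : Fin (L + 1) → Finset (Fin m × Fin n))
    (hX : ∀ i, X i = sketch (A i) B ((m + k) * B) (streamPairs S)) :
    (selectSets B k X).card = k ∧
      (1 - (1 - 1 / (k : ℝ)) ^ k - 2 * δ) * opt S k ≤ coverage S (selectSets B k X) := by
  set T : Fin m → Finset (Fin n) := fun i => (S i).toFinset with hT
  set ρ : ℝ := (1 - 1 / (k : ℝ)) ^ k with hρ
  have hρ2 : ρ ≤ 1 / 2 := one_sub_one_div_pow_le_half hk
  have hρ0 : 0 ≤ ρ := one_sub_one_div_pow_nonneg hk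
  have hk1 : (1 : ℝ) ≤ k := by exact_mod_cast hk
  have hB1 : (16 : ℝ) ≤ B := by exact_mod_cast hB
  have hkB : (16 : ℝ) ≤ (k : ℝ) * B := by nlinarith
  have hsk : ∀ (i : Fin (L + 1)) (V : ℝ), 0 ≤ V → V ≤ maxCover (sampled T (A i)) k →
      V ≤ k * B → (1 - ρ) * V ≤ maxCover (kept (X i)) k := by
    intro i V h0 h1 h2
    rw [hX i]
    exact le_maxCover_sketch S (A i) B k hk hkm h0 h1 h2
  have hsub : ∀ i j, kept (X i) j ⊆ sampled T (A i) j := by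
    intro i j
    rw [hX i]
    exact kept_sketch_subset S (A i) B _ j
  -- A sketch that is passed over has a large optimum.
  have hpass : ∀ i : Fin (L + 1), ¬ 2 * maxCover (kept (X i)) k < k * B →
      (k : ℝ) * B / 8 ≤ (1 / 2 : ℝ) ^ (i : ℕ) * opt S k := by
    intro i hi
    rw [opt_eq_maxCover]
    refine le_maxCover_of_concentrated hkm hδ (by positivity) (by positivity) (hA i) ?_
    have h1 : ((k * B : ℕ) : ℝ) ≤ ((2 * maxCover (sampled T (A i)) k : ℕ) : ℝ) := by
      have := maxCover_mono (hsub i) k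
      exact_mod_cast (not_lt.1 hi).trans (Nat.mul_le_mul_left 2 this)
    push_cast at h1
    linarith
  have hoptn : (opt S k : ℝ) ≤ n := by
    have : opt S k ≤ n := Finset.sup_le fun I _ => (Finset.card_le_univ _).trans (by simp)
    exact_mod_cast this
  have hex : ∃ i, ∃ hi : i < L + 1, 2 * maxCover (kept (X ⟨i, hi⟩)) k < k * B := by
    refine ⟨L, Nat.lt_succ_self L, ?_⟩
    by_contra hcon
    have h1 := hpass ⟨L, Nat.lt_succ_self L⟩ hcon
    have h2 : (n : ℝ) ≤ 2 ^ L := by exact_mod_cast hn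
    have h3 : (1 / 2 : ℝ) ^ L * opt S k ≤ (1 / 2 : ℝ) ^ L * 2 ^ L :=
      mul_le_mul_of_nonneg_left (hoptn.trans h2) (by positivity)
    rw [← mul_pow] at h3
    norm_num at h3 h1
    linarith
  obtain ⟨i, hiL, hsel, hi, hmin⟩ := selectSets_spec hex
  rw [hsel]
  obtain ⟨hJ, hJc⟩ := bestSets_spec (X ⟨i, hiL⟩) hkm
  set J := bestSets (X ⟨i, hiL⟩) k with hJdef
  refine ⟨hJ, ?_⟩
  set a : Fin (L + 1) := ⟨i, hiL⟩ with ha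
  set p : ℝ := (1 / 2 : ℝ) ^ i with hp
  have hp0 : 0 < p := by positivity
  have hiR : 2 * (maxCover (kept (X a)) k : ℝ) < k * B := by exact_mod_cast hi
  -- The sampled optimum is small enough for the sketch to be faithful.
  have hoptA : (maxCover (sampled T (A a)) k : ℝ) ≤ k * B := by
    by_contra hcon
    have h1 := hsk a (k * B) (by positivity) (not_le.1 hcon).le le_rfl
    have h2 : 1 / 2 * ((k : ℝ) * B) ≤ (1 - ρ) * (k * B) :=
      mul_le_mul_of_nonneg_right (by linarith) (by positivity)
    linarith
  have hval := hsk a _ (Nat.cast_nonneg _) le_rfl hoptA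
  have hJval : (maxCover (kept (X a)) k : ℝ) ≤ (J.biUnion (sampled T (A a))).card := by
    rw [← hJc]
    exact_mod_cast Finset.card_le_card (Finset.biUnion_mono fun j _ => hsub a j)
  have hcovJ : coverage S J = (J.biUnion T).card := rfl
  obtain ⟨O, hO, hOc⟩ := exists_card_biUnion_eq_maxCover T (k := k) (by simpa using hkm)
  have hOA : ((O.biUnion (sampled T (A a))).card : ℝ) ≤ maxCover (sampled T (A a)) k := by
    exact_mod_cast card_biUnion_le_maxCover _ hO
  rw [opt_eq_maxCover]
  have hJopt : ((J.biUnion T).card : ℝ) ≤ maxCover T k := by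
    exact_mod_cast card_biUnion_le_maxCover T hJ
  set M : ℝ := (maxCover T k : ℝ) with hM
  have hM0 : 0 ≤ M := Nat.cast_nonneg _
  rw [hcovJ]
  set c : ℝ := ((J.biUnion T).card : ℝ) with hc
  have hdev : (1 - ρ - 2 * δ) * (p * M) ≤ p * c := by
    rcases Nat.eq_zero_or_pos i with h0 | hpos
    · -- The first sketch holds the elements themselves.
      subst h0
      have hAu : A a = Finset.univ := hA0
      have hST : sampled T (A a) = T := by
        funext j
        simp [sampled, hAu]
      rw [hST] at hval hJval
      have hp1 : p = 1 := by simp [hp]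
      rw [hp1, one_mul, one_mul]
      have := mul_nonneg hδ0 hM0
      linarith
    · have h1 := hpass ⟨i - 1, by omega⟩ (hmin (i - 1) (by omega) (by omega))
      rw [opt_eq_maxCover] at h1
      have hpp : (1 / 2 : ℝ) ^ (i - 1) = 2 * p := by
        rw [hp]
        obtain ⟨j, rfl⟩ : ∃ j, i = j + 1 := ⟨i - 1, by omega⟩
        rw [Nat.add_sub_cancel, pow_succ]
        ring
      have hlarge : (k : ℝ) * B / 16 ≤ p * M := by
        have h2 : (k : ℝ) * B / 8 ≤ (1 / 2 : ℝ) ^ (i - 1) * M := h1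
        rw [hpp] at h2
        linarith
      have hcon : ∀ I : Finset (Fin m), I.card = k →
          |((I.biUnion (sampled T (A a))).card : ℝ) - p * (I.biUnion T).card| ≤ δ * (p * M) := by
        intro I hI
        refine (hA a I hI).trans (mul_le_mul_of_nonneg_left (max_le ?_ hlarge) hδ0)
        exact mul_le_mul_of_nonneg_left (Nat.cast_le.2 (card_biUnion_le_maxCover T hI)) hp0.le
      have hOd := (abs_le.1 (hcon O hO)).1
      have hJd := (abs_le.1 (hcon J hJ)).2
      rw [hOc] at hOd
      have h3 : (1 - ρ) * ((1 - δ) * (p * M)) ≤ (1 - ρ) * maxCover (sampled T (A a)) k :=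
        mul_le_mul_of_nonneg_left (by linarith) (by linarith)
      have h4 : 0 ≤ ρ * δ * (p * M) := by positivity
      have h5 : (1 - ρ) * ((1 - δ) * (p * M)) = (1 - ρ - δ) * (p * M) + ρ * δ * (p * M) := by ring
      linarith
  have h6 : p * ((1 - ρ - 2 * δ) * M) ≤ p * c := by linarith
  exact le_of_mul_le_mul_left h6 hp0

end Select

/-! ### Concentration of a random sample -/

section Chernoff

variable {ι κ : Type*} [Fintype ι] [DecidableEq ι] [Fintype κ]

theorem sum_prod_apply (f : ι → κ → ℝ) :
    ∑ h : ι → κ, ∏ e, f e (h e) = ∏ e, ∑ v, f e v := by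
  rw [Finset.prod_univ_sum, Fintype.piFinset_univ]

variable [DecidableEq κ]

/-- The elements of `ι` that the hash function `h` maps into `P`. -/
def hashSample (P : Finset κ) (h : ι → κ) : Finset ι :=
  Finset.univ.filter fun e => h e ∈ P

theorem sum_exp_card_inter_hashSample (P : Finset κ) (U : Finset ι) (t : ℝ) :
    ∑ h : ι → κ, Real.exp (t * (U ∩ hashSample P h).card) =
      (P.card * (Real.exp t - 1) + Fintype.card κ) ^ U.card *
        (Fintype.card κ : ℝ) ^ (Fintype.card ι - U.card) := by
  have h1 : ∀ h : ι → κ, Real.exp (t * (U ∩ hashSample P h).card) =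
      ∏ e, (if e ∈ U ∧ h e ∈ P then Real.exp t else 1) := by
    intro h
    rw [← Finset.prod_filter, Finset.prod_const, ← Real.exp_nat_mul, mul_comm]
    congr 4
    ext e
    simp [hashSample]
  simp_rw [h1]
  rw [sum_prod_apply fun e v => if e ∈ U ∧ v ∈ P then Real.exp t else 1]
  have h2 : ∀ e, ∑ v : κ, (if e ∈ U ∧ v ∈ P then Real.exp t else 1) =
      if e ∈ U then P.card * (Real.exp t - 1) + Fintype.card κ else (Fintype.card κ : ℝ) := by
    intro e
    by_cases he : e ∈ U
    · simp only [he, true_and, if_true]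
      have h3 : ∀ v : κ, (if v ∈ P then Real.exp t else 1) =
          (if v ∈ P then Real.exp t - 1 else 0) + 1 := by
        intro v
        split_ifs <;> ring
      simp_rw [h3, Finset.sum_add_distrib, ← Finset.sum_filter]
      simp only [Finset.filter_mem_eq_inter, Finset.univ_inter, Finset.sum_const, nsmul_eq_mul,
        Finset.card_univ, mul_one]
    · simp [he]
  simp_rw [h2]
  rw [Finset.prod_ite, Finset.prod_const, Finset.prod_const, Finset.filter_mem_eq_inter,
    Finset.univ_inter, Finset.filter_not, Finset.filter_mem_eq_inter, Finset.univ_inter,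
    Finset.card_sdiff_of_subset (Finset.subset_univ _), Finset.card_univ]

/-- The centred exponential moment of the size of a random sample of `U`. -/
theorem sum_exp_centred_le [Nonempty κ] (P : Finset κ) (U : Finset ι) {p t : ℝ}
    (hp : p * Fintype.card κ = P.card) (ht : |t| ≤ 1) :
    ∑ h : ι → κ, Real.exp (t * ((U ∩ hashSample P h).card - p * U.card)) ≤
      Real.exp (p * U.card * t ^ 2) * Fintype.card (ι → κ) := by
  have hκ : (0 : ℝ) < Fintype.card κ := by exact_mod_cast Fintype.card_pos
  have hp0 : 0 ≤ p := by
    by_contra hcon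
    have := mul_neg_of_neg_of_pos (not_le.1 hcon) hκ
    rw [hp] at this
    exact absurd (Nat.cast_nonneg P.card) (not_le.2 this)
  have hcard : ((Fintype.card (ι → κ) : ℕ) : ℝ) = (Fintype.card κ : ℝ) ^ U.card *
      (Fintype.card κ : ℝ) ^ (Fintype.card ι - U.card) := by
    rw [← pow_add, Nat.add_sub_cancel' (Finset.card_le_univ U), Fintype.card_fun]
    push_cast
    rfl
  have hsplit : ∀ h : ι → κ, Real.exp (t * ((U ∩ hashSample P h).card - p * U.card)) =
      Real.exp (-(t * (p * U.card))) * Real.exp (t * (U ∩ hashSample P h).card) := by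
    intro h
    rw [← Real.exp_add]
    congr 1
    ring
  simp_rw [hsplit]
  rw [← Finset.mul_sum, sum_exp_card_inter_hashSample, hcard]
  have hbase : (P.card : ℝ) * (Real.exp t - 1) + Fintype.card κ ≤
      Real.exp (p * (t + t ^ 2)) * Fintype.card κ := by
    have h1 : Real.exp t - 1 ≤ t + t ^ 2 := by
      have := (abs_le.1 (Real.abs_exp_sub_one_sub_id_le ht)).2
      linarith
    have h2 : 1 + p * (Real.exp t - 1) ≤ Real.exp (p * (t + t ^ 2)) := by
      have h3 := Real.add_one_le_exp (p * (t + t ^ 2))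
      have h4 := mul_le_mul_of_nonneg_left h1 hp0
      linarith
    rw [← hp]
    have := mul_le_mul_of_nonneg_right h2 hκ.le
    linarith
  have hbase0 : 0 ≤ (P.card : ℝ) * (Real.exp t - 1) + Fintype.card κ := by
    have h1 : (P.card : ℝ) ≤ Fintype.card κ := by exact_mod_cast Finset.card_le_univ P
    have h2 : (P.card : ℝ) * (Real.exp t - 1) + Fintype.card κ =
      P.card * Real.exp t + (Fintype.card κ - P.card) := by ring
    rw [h2]
    have := Real.exp_pos t
    have : 0 ≤ (P.card : ℝ) * Real.exp t := by positivity
    linarith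
  have hpow := pow_le_pow_left₀ hbase0 hbase U.card
  rw [mul_pow, ← Real.exp_nat_mul] at hpow
  calc Real.exp (-(t * (p * U.card))) * (((P.card : ℝ) * (Real.exp t - 1) + Fintype.card κ) ^ U.card *
        (Fintype.card κ : ℝ) ^ (Fintype.card ι - U.card))
      ≤ Real.exp (-(t * (p * U.card))) * ((Real.exp (U.card * (p * (t + t ^ 2))) *
        (Fintype.card κ : ℝ) ^ U.card) * (Fintype.card κ : ℝ) ^ (Fintype.card ι - U.card)) := by
        gcongr
    _ = (Real.exp (-(t * (p * U.card))) * Real.exp (U.card * (p * (t + t ^ 2)))) *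
        ((Fintype.card κ : ℝ) ^ U.card * (Fintype.card κ : ℝ) ^ (Fintype.card ι - U.card)) := by
        ring
    _ = _ := by
        rw [← Real.exp_add]
        congr 2
        ring

open Classical in
/-- The Chernoff bound for one of the two tails, according to the sign of `s`. -/
theorem card_tail_le [Nonempty κ] (P : Finset κ) (U : Finset ι) {p δ M s : ℝ}
    (hp : p * Fintype.card κ = P.card) (hδ0 : 0 ≤ δ) (hδ : δ ≤ 1) (hM : p * U.card ≤ M)
    (hs : |s| = 1) :
    ((Finset.univ.filter fun h : ι → κ =>
      δ * M < s * ((U ∩ hashSample P h).card - p * U.card)).card : ℝ) ≤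
      Real.exp (-(δ ^ 2 * M / 4)) * Fintype.card (ι → κ) := by
  have hs2 : s ^ 2 = 1 := by rw [← sq_abs, hs, one_pow]
  have ht : |s * (δ / 2)| ≤ 1 := by
    rw [abs_mul, hs, one_mul, abs_of_nonneg (by linarith)]
    linarith
  have h1 := sum_exp_centred_le P U hp ht
  set D := Finset.univ.filter fun h : ι → κ =>
      δ * M < s * ((U ∩ hashSample P h).card - p * U.card) with hD
  have h2 : (D.card : ℝ) * Real.exp (δ ^ 2 * M / 2) ≤
      ∑ h : ι → κ, Real.exp (s * (δ / 2) * ((U ∩ hashSample P h).card - p * U.card)) := by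
    rw [← nsmul_eq_mul]
    refine (Finset.card_nsmul_le_sum D _ _ fun h hh => ?_).trans
      (Finset.sum_le_sum_of_subset_of_nonneg (Finset.subset_univ D) fun _ _ _ =>
        (Real.exp_pos _).le)
    apply Real.exp_le_exp.2
    have h3 := (Finset.mem_filter.1 hh).2.le
    have h4 := mul_le_mul_of_nonneg_left h3 (by linarith : 0 ≤ δ / 2)
    calc δ ^ 2 * M / 2 = δ / 2 * (δ * M) := by ring
      _ ≤ _ := h4
      _ = _ := by ring
  have h5 : Real.exp (p * U.card * (s * (δ / 2)) ^ 2) ≤ Real.exp (δ ^ 2 * M / 4) := by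
    apply Real.exp_le_exp.2
    rw [mul_pow, hs2, one_mul]
    have := mul_le_mul_of_nonneg_right hM (sq_nonneg (δ / 2))
    calc _ ≤ _ := this
      _ = _ := by ring
  have h6 : (D.card : ℝ) * Real.exp (δ ^ 2 * M / 2) ≤
      Real.exp (δ ^ 2 * M / 4) * Fintype.card (ι → κ) :=
    h2.trans (h1.trans (mul_le_mul_of_nonneg_right h5 (Nat.cast_nonneg _)))
  have h7 := mul_le_mul_of_nonneg_right h6 (Real.exp_pos (-(δ ^ 2 * M / 2))).le
  rw [mul_assoc, ← Real.exp_add, add_neg_cancel, Real.exp_zero, mul_one, mul_right_comm,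
    ← Real.exp_add] at h7
  refine h7.trans_eq ?_
  congr 2
  ring

open Classical in
theorem card_deviation_le [Nonempty κ] (P : Finset κ) (U : Finset ι) {p δ r : ℝ}
    (hp : p * Fintype.card κ = P.card) (hδ0 : 0 ≤ δ) (hδ : δ ≤ 1) :
    ((Finset.univ.filter fun h : ι → κ => ¬ |((U ∩ hashSample P h).card : ℝ) - p * U.card| ≤
      δ * max (p * U.card) r).card : ℝ) ≤
      2 * Real.exp (-(δ ^ 2 * r / 4)) * Fintype.card (ι → κ) := by
  set M := max (p * U.card) r with hM
  have h1 := card_tail_le P U (M := M) (s := 1) hp hδ0 hδ (le_max_left _ _) (by simp)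
  have h2 := card_tail_le P U (M := M) (s := -1) hp hδ0 hδ (le_max_left _ _) (by simp)
  have h3 : Real.exp (-(δ ^ 2 * M / 4)) ≤ Real.exp (-(δ ^ 2 * r / 4)) := by
    apply Real.exp_le_exp.2
    have := mul_le_mul_of_nonneg_left (le_max_right (p * U.card) r) (sq_nonneg δ)
    rw [← hM] at this
    linarith
  have h4 := mul_le_mul_of_nonneg_right h3 (Nat.cast_nonneg (α := ℝ) (Fintype.card (ι → κ)))
  refine le_trans ?_ ((add_le_add (h1.trans h4) (h2.trans h4)).trans_eq (by ring))
  rw [← Nat.cast_add, Nat.cast_le]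
  refine (Finset.card_le_card ?_).trans (Finset.card_union_le _ _)
  intro h hh
  have hh := (Finset.mem_filter.1 hh).2
  rw [not_le, lt_abs] at hh
  rw [Finset.mem_union, Finset.mem_filter, Finset.mem_filter]
  rcases hh with hh | hh
  · exact Or.inl ⟨Finset.mem_univ _, by rw [one_mul]; exact hh⟩
  · exact Or.inr ⟨Finset.mem_univ _, by rw [neg_one_mul]; exact hh⟩

end Chernoff

section Levels

variable {n m : ℕ}

/-- The sample of rate `1 / 2 ^ i` defined by a hash function with `2 ^ L` values. -/
def levelSample {L : ℕ} (h : Fin n → Fin (2 ^ L)) (i : ℕ) : Finset (Fin n) :=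
  hashSample (Finset.univ.filter fun v : Fin (2 ^ L) => v.val < 2 ^ (L - i)) h

theorem levelSample_zero {L : ℕ} (h : Fin n → Fin (2 ^ L)) : levelSample h 0 = Finset.univ := by
  ext e
  simp [levelSample, hashSample]

theorem biUnion_sampled (S : Fin m → Finset (Fin n)) (A : Finset (Fin n)) (I : Finset (Fin m)) :
    I.biUnion (sampled S A) = I.biUnion S ∩ A := by
  ext e
  simp only [sampled, Finset.mem_biUnion, Finset.mem_inter]
  tauto

open Classical in
/-- The hash functions for which one of the samples is not concentrated. -/
noncomputable def badHashes (S : Fin m → Finset (Fin n)) (k L : ℕ) (δ r : ℝ) :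
    Finset (Fin n → Fin (2 ^ L)) :=
  Finset.univ.filter fun h =>
    ¬ ∀ i : Fin (L + 1), Concentrated S k ((1 / 2 : ℝ) ^ (i : ℕ)) δ r (levelSample h i)

theorem card_badHashes_le (S : Fin m → Finset (Fin n)) (k L : ℕ) {δ r : ℝ} (hδ0 : 0 ≤ δ)
    (hδ : δ ≤ 1) :
    ((badHashes S k L δ r).card : ℝ) ≤
      (L + 1) * (m : ℝ) ^ k *
        (2 * Real.exp (-(δ ^ 2 * r / 4)) * Fintype.card (Fin n → Fin (2 ^ L))) := by
  classical
  set E : ℝ := 2 * Real.exp (-(δ ^ 2 * r / 4)) * Fintype.card (Fin n → Fin (2 ^ L)) with hE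
  have hE0 : 0 ≤ E := by positivity
  set Is := (Finset.univ : Finset (Fin m)).powersetCard k with hIs
  let D : Fin (L + 1) × Finset (Fin m) → Finset (Fin n → Fin (2 ^ L)) := fun x =>
    Finset.univ.filter fun h => ¬ |((x.2.biUnion S ∩ levelSample h x.1).card : ℝ) -
      (1 / 2 : ℝ) ^ (x.1 : ℕ) * (x.2.biUnion S).card| ≤
      δ * max ((1 / 2 : ℝ) ^ (x.1 : ℕ) * (x.2.biUnion S).card) r
  have hD : ∀ x, ((D x).card : ℝ) ≤ E := by
    intro x
    refine card_deviation_le _ (x.2.biUnion S) ?_ hδ0 hδ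
    have hx : (x.1 : ℕ) ≤ L := Nat.lt_succ_iff.1 x.1.2
    have hc : (Finset.univ.filter fun v : Fin (2 ^ L) => v.val < 2 ^ (L - (x.1 : ℕ))).card =
        2 ^ (L - (x.1 : ℕ)) := by
      rw [Fin.card_filter_val_lt, min_eq_right (Nat.pow_le_pow_right (by norm_num) (Nat.sub_le _ _))]
    rw [hc, Fintype.card_fin]
    push_cast
    rw [pow_sub₀ _ two_ne_zero hx, one_div_pow]
    ring
  have hsub : badHashes S k L δ r ⊆ (Finset.univ ×ˢ Is).biUnion D := by
    intro h hh
    have hh := (Finset.mem_filter.1 hh).2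
    unfold Concentrated at hh
    push Not at hh
    obtain ⟨i, I, hI, hlt⟩ := hh
    rw [biUnion_sampled] at hlt
    refine Finset.mem_biUnion.2 ⟨(i, I), Finset.mem_product.2 ⟨Finset.mem_univ _,
      Finset.mem_powersetCard.2 ⟨Finset.subset_univ _, hI⟩⟩, Finset.mem_filter.2
      ⟨Finset.mem_univ _, not_le.2 hlt⟩⟩
  have h1 : ((badHashes S k L δ r).card : ℝ) ≤ ∑ x ∈ Finset.univ ×ˢ Is, ((D x).card : ℝ) := by
    exact_mod_cast (Finset.card_le_card hsub).trans Finset.card_biUnion_le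
  refine h1.trans ((Finset.sum_le_card_nsmul _ _ E fun x _ => hD x).trans ?_)
  rw [nsmul_eq_mul]
  refine mul_le_mul_of_nonneg_right ?_ hE0
  rw [Finset.card_product, Finset.card_univ, Fintype.card_fin, hIs, Finset.card_powersetCard,
    Finset.card_univ, Fintype.card_fin]
  have := Nat.choose_le_pow m k
  push_cast
  have h2 : ((m.choose k : ℕ) : ℝ) ≤ (m : ℝ) ^ k := by exact_mod_cast this
  exact mul_le_mul_of_nonneg_left h2 (by positivity)

/-- With `B = 256 q ^ 2 (a + 4) l`, accuracy `1 / (2 q)` and `2 ^ l ≥ m`, all but a fraction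
`2 ^ (-(a + 1) l)` of the hash functions are good. -/
theorem card_badHashes_mul_le (a : ℕ) (S : Fin m → Finset (Fin n)) {k l q : ℕ} (hk : 0 < k)
    (hm : m ≤ 2 ^ l) (hl : 0 < l) (hq : 0 < q) :
    (badHashes S k l (1 / (2 * q)) ((k : ℝ) * (256 * q ^ 2 * (a + 4) * l : ℕ) / 16)).card *
      2 ^ ((a + 1) * l) ≤ Fintype.card (Fin n → Fin (2 ^ l)) := by
  have hq1 : (1 : ℝ) ≤ q := by exact_mod_cast hq
  have hq0 : (q : ℝ) ≠ 0 := by positivity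
  have h1 := card_badHashes_le S k l (δ := 1 / (2 * q))
    (r := (k : ℝ) * (256 * q ^ 2 * (a + 4) * l : ℕ) / 16) (by positivity)
    (by rw [div_le_one (by positivity)]; linarith)
  set N := (badHashes S k l (1 / (2 * q)) ((k : ℝ) * (256 * q ^ 2 * (a + 4) * l : ℕ) / 16)).card
  set W := Fintype.card (Fin n → Fin (2 ^ l))
  -- The constants in `B` make the exponent of the Chernoff bound equal to `-(k * (a + 4) * l)`. The
  -- factor `k` pays for the union bound over the `m ^ k` families.
  have hexp : Real.exp (-((1 / (2 * (q : ℝ))) ^ 2 *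
      ((k : ℝ) * (256 * q ^ 2 * (a + 4) * l : ℕ) / 16) / 4)) ≤
      1 / 2 ^ (k * ((a + 4) * l)) := by
    have h2 : -((1 / (2 * (q : ℝ))) ^ 2 * ((k : ℝ) * (256 * q ^ 2 * (a + 4) * l : ℕ) / 16) / 4) =
        ((k * ((a + 4) * l) : ℕ) : ℝ) * (-1) := by
      push_cast
      field_simp
      norm_num
    rw [h2, Real.exp_nat_mul, ← one_div_pow]
    refine pow_le_pow_left₀ (Real.exp_pos _).le ?_ _
    rw [Real.exp_neg, inv_eq_one_div]
    have := Real.add_one_le_exp (1 : ℝ)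
    exact one_div_le_one_div_of_le (by norm_num) (by linarith)
  have h3 : (N : ℝ) ≤ ((l + 1 : ℕ) : ℝ) * (m : ℝ) ^ k * (2 * (1 / 2 ^ (k * ((a + 4) * l))) * W) := by
    refine h1.trans ?_
    rw [Nat.cast_succ]
    gcongr
  have h4 : (N : ℝ) * 2 ^ (k * ((a + 4) * l)) ≤ ((l + 1) * m ^ k * 2 * W : ℕ) := by
    have hpos : (0 : ℝ) < 2 ^ (k * ((a + 4) * l)) := by positivity
    rw [← le_div_iff₀ hpos]
    refine h3.trans_eq ?_
    push_cast
    ring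
  have h5 : N * 2 ^ (k * ((a + 4) * l)) ≤ (l + 1) * m ^ k * 2 * W := by exact_mod_cast h4
  have h6 : (l + 1) * m ^ k * 2 * W ≤ 2 ^ l * (2 ^ l) ^ k * 2 ^ l * W := by
    have h7 : l + 1 ≤ 2 ^ l := Nat.lt_two_pow_self
    have h8 : 2 ≤ 2 ^ l := by
      calc 2 = 2 ^ 1 := rfl
        _ ≤ 2 ^ l := Nat.pow_le_pow_right (by norm_num) hl
    gcongr
  have h9 : 2 ^ l * (2 ^ l) ^ k * 2 ^ l = 2 ^ (l * (k + 2)) := by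
    rw [← pow_mul, ← pow_add, ← pow_add]
    congr 1
    ring
  rw [h9] at h6
  have h10 : l * (k + 2) + (a + 1) * l ≤ k * ((a + 4) * l) := by
    obtain ⟨j, rfl⟩ : ∃ j, k = j + 1 := ⟨k - 1, by omega⟩
    have : (j + 1) * ((a + 4) * l) = l * (j + 1 + 2) + (a + 1) * l + j * (a + 3) * l := by ring
    omega
  have h11 : N * 2 ^ ((a + 1) * l) * 2 ^ (l * (k + 2)) ≤ W * 2 ^ (l * (k + 2)) := by
    calc N * 2 ^ ((a + 1) * l) * 2 ^ (l * (k + 2)) = N * 2 ^ (l * (k + 2) + (a + 1) * l) := by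
          rw [pow_add]; ring
      _ ≤ N * 2 ^ (k * ((a + 4) * l)) := by gcongr; norm_num
      _ ≤ 2 ^ (l * (k + 2)) * W := h5.trans h6
      _ = _ := mul_comm _ _
  exact Nat.le_of_mul_le_mul_right h11 (by positivity)

end Levels

/-! ### Few hash functions suffice for all inputs -/

open Classical in
/-- If a random element of `Ω` is bad for each input with probability at most `1 / T`, then there is
a family of `T` elements, of which fewer than `R` are bad for each of the at most `2 ^ R / 4`
inputs. The expectation of `2` to the number of bad elements of a random family is at
most `(1 + 1 / T) ^ T < 4`. -/
theorem exists_family_few_bad {Ω ι τ : Type*} [Fintype Ω] [Nonempty Ω] [Fintype ι]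
    [Fintype τ] (bad : ι → Finset Ω) {T R : ℕ} (hτ : Fintype.card τ = T) (hT : 0 < T) (hbad : ∀ c, (bad c).card * T ≤ Fintype.card Ω)
    (hR : 4 * Fintype.card ι ≤ 2 ^ R) :
    ∃ f : τ → Ω, ∀ c, (Finset.univ.filter fun j => f j ∈ bad c).card < R := by
  by_contra! hcon
  have hT' : (0 : ℝ) < T := by exact_mod_cast hT
  set W : ℝ := (Fintype.card Ω : ℝ) with hW
  have hW0 : 0 < W := by
    rw [hW]
    exact_mod_cast Fintype.card_pos
  have hmoment : ∀ c, ∑ f : τ → Ω,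
      (2 : ℝ) ^ (Finset.univ.filter fun j => f j ∈ bad c).card ≤ 3 * W ^ T := by
    intro c
    have h1 : ∀ f : τ → Ω, (2 : ℝ) ^ (Finset.univ.filter fun j => f j ∈ bad c).card =
        ∏ j, if f j ∈ bad c then (2 : ℝ) else 1 := by
      intro f
      rw [← Finset.prod_filter, Finset.prod_const]
    simp_rw [h1]
    rw [sum_prod_apply fun (_ : τ) (v : Ω) => if v ∈ bad c then (2 : ℝ) else 1]
    have h2 : ∑ v : Ω, (if v ∈ bad c then (2 : ℝ) else 1) = W + (bad c).card := by
      have h3 : ∀ v : Ω, (if v ∈ bad c then (2 : ℝ) else 1) = 1 + if v ∈ bad c then (1 : ℝ) else 0 := by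
        intro v
        split_ifs <;> norm_num
      simp_rw [h3, Finset.sum_add_distrib, ← Finset.sum_filter]
      simp [hW]
    rw [h2, Finset.prod_const, Finset.card_univ, hτ]
    have h4 : W + (bad c).card ≤ W * Real.exp (1 / T) := by
      have h5 : ((bad c).card : ℝ) * T ≤ W := by
        rw [hW]
        exact_mod_cast hbad c
      have h6 := mul_le_mul_of_nonneg_left (Real.add_one_le_exp (1 / (T : ℝ))) hW0.le
      rw [← le_div_iff₀ hT'] at h5
      have h7 : W * (1 / (T : ℝ) + 1) = W / T + W := by ring
      linarith
    calc (W + (bad c).card) ^ T ≤ (W * Real.exp (1 / T)) ^ T :=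
          pow_le_pow_left₀ (by positivity) h4 T
      _ = Real.exp 1 * W ^ T := by
          rw [mul_pow, ← Real.exp_nat_mul, mul_one_div_cancel hT'.ne', mul_comm]
      _ ≤ 3 * W ^ T := by
          have := Real.exp_one_lt_d9
          exact mul_le_mul_of_nonneg_right (by linarith) (by positivity)
  have hlow : (2 : ℝ) ^ R * W ^ T ≤
      ∑ f : τ → Ω, ∑ c, (2 : ℝ) ^ (Finset.univ.filter fun j => f j ∈ bad c).card := by
    have h1 : (2 : ℝ) ^ R * W ^ T = ∑ _f : τ → Ω, (2 : ℝ) ^ R := by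
      rw [Finset.sum_const, Finset.card_univ, Fintype.card_fun, hτ, nsmul_eq_mul, hW]
      push_cast
      ring
    rw [h1]
    refine Finset.sum_le_sum fun f _ => ?_
    obtain ⟨c, hc⟩ := hcon f
    refine le_trans (pow_le_pow_right₀ (by norm_num) hc) ?_
    exact Finset.single_le_sum
      (f := fun c => (2 : ℝ) ^ (Finset.univ.filter fun j => f j ∈ bad c).card)
      (fun _ _ => by positivity) (Finset.mem_univ c)
  rw [Finset.sum_comm] at hlow
  have hup := hlow.trans (Finset.sum_le_card_nsmul _ _ _ fun c _ => hmoment c)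
  rw [nsmul_eq_mul, ← mul_assoc] at hup
  have h8 := le_of_mul_le_mul_right hup (by positivity)
  have h9 : (4 : ℝ) * Fintype.card ι ≤ 2 ^ R := by exact_mod_cast hR
  rw [Finset.card_univ] at h8
  have h10 : (0 : ℝ) < 2 ^ R := by positivity
  linarith

/-! ### The sketches as a machine with few states -/

section Machine

theorem card_finset_card_le (α : Type*) [Fintype α] (N : ℕ) :
    Fintype.card {X : Finset α // X.card ≤ N} ≤ (Fintype.card α + 1) ^ N := by
  classical
  have h : Fintype.card (Fin N → Option α) = (Fintype.card α + 1) ^ N := by simp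
  rw [← h]
  let g : (Fin N → Option α) → {X : Finset α // X.card ≤ N} := fun f =>
    ⟨(Finset.univ.image f).eraseNone, by
      exact (Finset.card_eraseNone_le _).trans (Finset.card_image_le.trans (by simp))⟩
  refine Fintype.card_le_of_surjective g ?_
  rintro ⟨X, hX⟩
  refine ⟨fun i => X.toList[(i : ℕ)]?, Subtype.ext ?_⟩
  ext x
  simp only [g, Finset.mem_eraseNone, Finset.mem_image, Finset.mem_univ, true_and]
  rw [← Finset.mem_toList, List.mem_iff_getElem?]
  constructor
  · rintro ⟨i, hi⟩
    exact ⟨i, hi⟩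
  · rintro ⟨i, hi⟩
    have h2 := (List.getElem?_eq_some_iff.1 hi).1
    rw [Finset.length_toList] at h2
    exact ⟨⟨i, h2.trans_le hX⟩, hi⟩

variable {n m : ℕ} {τ : Type*}

/-- The states of the streaming algorithm: the index of the hash function, the ID announced last, and
the sketches of the levels, with at most `N` pairs each. -/
abbrev SketchState (τ : Type*) (n m L N : ℕ) : Type _ :=
  τ × Fin m × (Fin (L + 1) → {X : Finset (Fin m × Fin n) // X.card ≤ N})

/-- The transition at an item of the stream. Numbers out of range are ignored. -/
noncomputable def nextState {L : ℕ} (B M : ℕ) (f : τ → Fin n → Fin (2 ^ L))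
    (σ : SketchState τ n m L (M + 1)) : Item → SketchState τ n m L (M + 1)
  | Sum.inl i => if h : i < m then (σ.1, ⟨i, h⟩, σ.2.2) else σ
  | Sum.inr e =>
    if h : e < n then
      (σ.1, σ.2.1, fun i => ⟨sketchStep (levelSample (f σ.1) i) B M (σ.2.2 i).1 (σ.2.1, ⟨e, h⟩),
        card_sketchStep_le _ _ _ (σ.2.2 i).2 _⟩)
    else σ

theorem foldl_nextState_elements {L : ℕ} (B M : ℕ) (f : τ → Fin n → Fin (2 ^ L)) (l : List (Fin n))
    (σ : SketchState τ n m L (M + 1)) :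
    let σ' := (l.map fun e => (Sum.inr e.val : Item)).foldl (nextState B M f) σ
    σ'.1 = σ.1 ∧ ∀ i, (σ'.2.2 i).1 = (l.map fun e => (σ.2.1, e)).foldl
      (sketchStep (levelSample (f σ.1) i) B M) (σ.2.2 i).1 := by
  induction l generalizing σ with
  | nil => exact ⟨rfl, fun i => rfl⟩
  | cons e l ih =>
    have h : nextState B M f σ (Sum.inr e.val) =
      (σ.1, σ.2.1, fun i => ⟨sketchStep (levelSample (f σ.1) i) B M (σ.2.2 i).1 (σ.2.1, e),
        card_sketchStep_le _ _ _ (σ.2.2 i).2 _⟩) := by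
      simp [nextState]
    simp only [List.map_cons, List.foldl_cons]
    rw [h]
    exact ih _

theorem foldl_nextState_flatMap {L : ℕ} (B M : ℕ) (f : τ → Fin n → Fin (2 ^ L))
    (S : Fin m → List (Fin n)) (l : List (Fin m)) (σ : SketchState τ n m L (M + 1)) :
    let σ' := (l.flatMap fun i : Fin m =>
      (Sum.inl i.val : Item) :: (S i).map fun e : Fin n => Sum.inr e.val).foldl (nextState B M f) σ
    σ'.1 = σ.1 ∧ ∀ i, (σ'.2.2 i).1 = (l.flatMap fun i => (S i).map fun e => (i, e)).foldl
      (sketchStep (levelSample (f σ.1) i) B M) (σ.2.2 i).1 := by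
  induction l generalizing σ with
  | nil => exact ⟨rfl, fun i => rfl⟩
  | cons j l ih =>
    have h : nextState B M f σ (Sum.inl j.val) = (σ.1, j, σ.2.2) := by
      simp [nextState]
    simp only [List.flatMap_cons, List.cons_append, List.foldl_cons, List.foldl_append]
    rw [h]
    have h1 := foldl_nextState_elements B M f (S j) (σ.1, j, σ.2.2)
    generalize ((S j).map fun e => (Sum.inr e.val : Item)).foldl (nextState B M f)
      (σ.1, j, σ.2.2) = σ₁ at h1 ⊢
    obtain ⟨h2, h3⟩ := ih σ₁
    refine ⟨h2.trans h1.1, fun i => (h3 i).trans ?_⟩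
    rw [h1.2 i, h1.1]

/-- The state before the first item. -/
def initState {L N : ℕ} (hm : 0 < m) (j : τ) : SketchState τ n m L N :=
  (j, ⟨0, hm⟩, fun _ => ⟨∅, by simp⟩)

theorem foldl_nextState_stream {L : ℕ} (B M : ℕ) (f : τ → Fin n → Fin (2 ^ L))
    (S : Fin m → List (Fin n)) (hm : 0 < m) (j : τ) (i : Fin (L + 1)) :
    (((stream S).foldl (nextState B M f) (initState hm j)).2.2 i).1 =
      sketch (levelSample (f j) i) B M (streamPairs S) :=
  (foldl_nextState_flatMap B M f S (List.finRange m) (initState hm j)).2 i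

theorem exists_injective_bits {σ : Type*} [Fintype σ] {s : ℕ} (h : Fintype.card σ ≤ 2 ^ s) :
    ∃ enc : σ → List Bool, Function.Injective enc ∧ ∀ x, (enc x).length ≤ s := by
  obtain ⟨g⟩ := Function.Embedding.nonempty_of_card_le (α := σ) (β := Fin s → Bool)
    (by simpa using h)
  exact ⟨fun x => List.ofFn (g x), List.ofFn_injective.comp g.injective, fun x => by simp⟩

/-- The number of bits granted to the memory, where `l` is about `log₂ (m * n)`. -/
def spaceBound (a m q l : ℕ) : ℕ := 1027 * (a + 4) * m * q ^ 2 * l ^ 3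

theorem card_sketchState_le (a : ℕ) {k q l : ℕ} (hm : 0 < m) (hkm : k ≤ m) (hq : 0 < q)
    (hl : m * n + 2 ≤ 2 ^ l) (hn : 0 < n) :
    Fintype.card (SketchState (Fin ((a + 1) * l) → Bool) n m l
      ((m + k) * (256 * q ^ 2 * (a + 4) * l) + 1)) ≤ 2 ^ spaceBound a m q l := by
  have hl1 : 1 ≤ l := by
    rcases Nat.eq_zero_or_pos l with rfl | h
    · omega
    · exact h
  set N := (m + k) * (256 * q ^ 2 * (a + 4) * l) + 1 with hN
  have h1 := card_finset_card_le (Fin m × Fin n) N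
  rw [Fintype.card_prod, Fintype.card_fin, Fintype.card_fin] at h1
  have h2 : Fintype.card {X : Finset (Fin m × Fin n) // X.card ≤ N} ≤ 2 ^ (l * N) := by
    rw [pow_mul]
    exact h1.trans (Nat.pow_le_pow_left (by omega) N)
  have hml : m ≤ 2 ^ l := by nlinarith
  rw [Fintype.card_prod, Fintype.card_prod, Fintype.card_fun, Fintype.card_fun, Fintype.card_fin,
    Fintype.card_fin, Fintype.card_fin, Fintype.card_bool]
  have h3 : 2 ^ ((a + 1) * l) * (m * Fintype.card {X : Finset (Fin m × Fin n) // X.card ≤ N} ^ (l + 1))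
      ≤ 2 ^ ((a + 1) * l) * (2 ^ l * (2 ^ (l * N)) ^ (l + 1)) := by
    gcongr
  refine h3.trans ?_
  rw [← pow_mul, ← pow_add, ← pow_add]
  refine Nat.pow_le_pow_right (by norm_num) ?_
  have hmq : 1 ≤ m * q ^ 2 := Nat.mul_pos hm (pow_pos hq 2)
  have hN' : N ≤ 513 * (m * q ^ 2) * (a + 4) * l := by
    have h4 : (m + k) * (256 * q ^ 2 * (a + 4) * l) ≤ (m + m) * (256 * q ^ 2 * (a + 4) * l) := by
      gcongr
    have h5 : 1 ≤ (m * q ^ 2) * (a + 4) * l := Nat.mul_pos (Nat.mul_pos hmq (by omega)) hl1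
    have h6 : (m + m) * (256 * q ^ 2 * (a + 4) * l) = 512 * ((m * q ^ 2) * (a + 4) * l) := by ring
    have h7 : 513 * (m * q ^ 2) * (a + 4) * l = 513 * ((m * q ^ 2) * (a + 4) * l) := by ring
    omega
  have h8 : (a + 1) * l + l ≤ (a + 4) * (m * q ^ 2) * l ^ 3 := by
    have h9 : l ≤ m * q ^ 2 * l ^ 3 := by
      calc l = 1 * l ^ 1 := by ring
        _ ≤ m * q ^ 2 * l ^ 3 := by gcongr; norm_num
    calc (a + 1) * l + l ≤ (a + 4) * l := by nlinarith
      _ ≤ (a + 4) * (m * q ^ 2 * l ^ 3) := by gcongr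
      _ = _ := by ring
  have h10 : l * N * (l + 1) ≤ 1026 * (a + 4) * (m * q ^ 2) * l ^ 3 := by
    calc l * N * (l + 1) ≤ l * (513 * (m * q ^ 2) * (a + 4) * l) * (2 * l) := by gcongr; omega
      _ = _ := by ring
  have h11 : spaceBound a m q l =
      (a + 4) * (m * q ^ 2) * l ^ 3 + 1026 * (a + 4) * (m * q ^ 2) * l ^ 3 := by
    unfold spaceBound
    ring
  rw [h11]
  omega

open Classical in
/-- For all values of the parameters there is a machine that solves maximum coverage. -/
theorem exists_machine (a : ℕ) {n m k q l : ℕ} (hn : 0 < n) (hk : 0 < k) (hkm : k ≤ m) (hq : 0 < q)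
    (hl : m * n + 2 ≤ 2 ^ l) :
    ∃ (init : List Bool → List Bool) (step : List Bool → Item → List Bool)
      (output : List Bool → List ℕ),
      (∀ r, (init r).length ≤ spaceBound a m q l) ∧
      (∀ w x, (step w x).length ≤ spaceBound a m q l) ∧
      ∀ S : Fin m → List (Fin n),
        (Finset.univ.filter fun r : Fin ((a + 1) * l) → Bool =>
          ¬ IsApproxSolution S k (1 - (1 - 1 / (k : ℝ)) ^ k - 1 / q)
            (output ((stream S).foldl step (init (List.ofFn r))))).card * (m * n) ^ a ≤
          2 ^ ((a + 1) * l) := by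
  have hm : 0 < m := hk.trans_le hkm
  have hl1 : 0 < l := by
    rcases Nat.eq_zero_or_pos l with rfl | h
    · omega
    · exact h
  have hml : m ≤ 2 ^ l := by nlinarith
  have hnl : n ≤ 2 ^ l := by nlinarith
  set t := (a + 1) * l with ht
  set B := 256 * q ^ 2 * (a + 4) * l with hB
  have hB16 : 16 ≤ B := by
    have : 1 ≤ q ^ 2 * (a + 4) * l := Nat.mul_pos (Nat.mul_pos (pow_pos hq 2) (by omega)) hl1
    have h2 : B = 256 * (q ^ 2 * (a + 4) * l) := by rw [hB]; ring
    omega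
  set bad : (Fin m → Finset (Fin n)) → Finset (Fin n → Fin (2 ^ l)) := fun T =>
    badHashes T k l (1 / (2 * q)) ((k : ℝ) * (B : ℕ) / 16) with hbad
  have : Nonempty (Fin n → Fin (2 ^ l)) := ⟨fun _ => ⟨0, by positivity⟩⟩
  obtain ⟨f, hf⟩ := exists_family_few_bad (τ := Fin t → Bool) bad (T := 2 ^ t) (R := m * n + 2)
    (by simp) (by positivity) (fun T => card_badHashes_mul_le a T hk hml hl1 hq) (by
      rw [Fintype.card_fun, Fintype.card_finset, Fintype.card_fin, Fintype.card_fin, ← pow_mul,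
        mul_comm n m, pow_add, mul_comm]
      norm_num)
  have hf : ∀ T, (Finset.univ.filter fun r => f r ∈ bad T).card < m * n + 2 := fun T => by
    convert hf T
  set M := (m + k) * B with hM
  have hcard : Fintype.card (SketchState (Fin t → Bool) n m l (M + 1)) ≤
      2 ^ spaceBound a m q l := card_sketchState_le a hm hkm hq hl hn
  obtain ⟨enc, henc, henc_len⟩ := exists_injective_bits hcard
  have : Nonempty (SketchState (Fin t → Bool) n m l (M + 1)) := ⟨initState hm fun _ => false⟩
  set dec := Function.invFun enc with hdec
  have hde : ∀ σ, dec (enc σ) = σ := Function.leftInverse_invFun henc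
  refine ⟨fun r => enc (initState hm fun i => r.getD i false),
    fun w x => enc (nextState B M f (dec w) x),
    fun w => (selectSets B k fun i => ((dec w).2.2 i).1).toList.map Fin.val,
    fun r => henc_len _, fun w x => henc_len _, fun S => ?_⟩
  set T : Fin m → Finset (Fin n) := fun i => (S i).toFinset with hT
  have hfold : ∀ (items : List Item) (σ : SketchState (Fin t → Bool) n m l (M + 1)),
      items.foldl (fun w x => enc (nextState B M f (dec w) x)) (enc σ) =
        enc (items.foldl (nextState B M f) σ) := by
    intro items
    induction items with
    | nil => exact fun σ => rfl
    | cons x items ih =>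
      intro σ
      rw [List.foldl_cons, List.foldl_cons, hde]
      exact ih _
  have hsub : (Finset.univ.filter fun r : Fin t → Bool =>
      ¬ IsApproxSolution S k (1 - (1 - 1 / (k : ℝ)) ^ k - 1 / q)
        ((selectSets B k fun i => ((dec ((stream S).foldl
          (fun w x => enc (nextState B M f (dec w) x))
          (enc (initState hm fun i => (List.ofFn r).getD i false)))).2.2 i).1).toList.map
            Fin.val)) ⊆ Finset.univ.filter fun r => f r ∈ bad T := by
    intro r hr
    have hr := (Finset.mem_filter.1 hr).2
    refine Finset.mem_filter.2 ⟨Finset.mem_univ _, ?_⟩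
    by_contra hgood
    apply hr
    have hr0 : (fun i : Fin t => (List.ofFn r).getD i false) = r := by
      funext i
      simp [List.getD]
    rw [hfold, hde, hr0]
    have hconc : ∀ i : Fin (l + 1), Concentrated T k ((1 / 2 : ℝ) ^ (i : ℕ)) (1 / (2 * q))
        ((k : ℝ) * B / 16) (levelSample (f r) i) := by
      by_contra hcon
      exact hgood (Finset.mem_filter.2 ⟨Finset.mem_univ _, hcon⟩)
    have hq1 : (1 : ℝ) ≤ q := by exact_mod_cast hq
    obtain ⟨h1, h2⟩ := le_coverage_selectSets S hk hkm hnl hB16 (δ := 1 / (2 * q)) (by positivity)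
      (by rw [div_le_one (by positivity)]; linarith) (fun i => levelSample (f r) i)
      (levelSample_zero _) hconc _ fun i => foldl_nextState_stream B M f S hm r i
    refine ⟨_, h1, ?_, ?_⟩
    · ext x
      simp
    · have h3 : 2 * (1 / (2 * (q : ℝ))) = 1 / q := by
        field_simp
      rw [h3] at h2
      exact h2
  have h1 := (Finset.card_le_card hsub).trans (hf T).le
  calc _ ≤ (m * n + 2) * (m * n) ^ a := Nat.mul_le_mul_right _ h1
    _ ≤ 2 ^ l * (2 ^ l) ^ a := by gcongr; omega
    _ = 2 ^ t := by rw [← pow_succ', ← pow_mul, ht, mul_comm]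

end Machine

/-! ### Machines given by tables -/

/-- A machine for one value of the parameters: a number `l`, about `log₂ (m * n)`, and the tables of
the initial memories, of the transitions and of the outputs. The entries are looked up at
the codes of the arguments. -/
abbrev Table : Type := ℕ × List (List Bool) × List (List Bool) × List (List ℕ)

/-- The memory at the start. It is cut off at the number of bits that is granted, as are
all later ones. -/
def tableInit (a : ℕ) (p : Params) (G : Table) (r : List Bool) : List Bool :=
  (G.2.1.getD (Encodable.encode r) []).take (spaceBound a p.2.1 p.2.2.2 G.1)

/-- The memory `w` after the item `x`. -/
def tableStep (a : ℕ) (p : Params) (G : Table) (w : List Bool) (x : Item) : List Bool :=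
  (G.2.2.1.getD (Encodable.encode (w, x)) []).take (spaceBound a p.2.1 p.2.2.2 G.1)

/-- The output computed from the memory `w`. -/
def tableOutput (G : Table) (w : List Bool) : List ℕ :=
  G.2.2.2.getD (Encodable.encode w) []

/-- The output on a list of items, for the random bits `r`. -/
def tableRun (a : ℕ) (p : Params) (G : Table) (items : List Item) (r : List Bool) : List ℕ :=
  tableOutput G (items.foldl (tableStep a p G) (tableInit a p G r))

/-! ### A decidable test for machines -/

/-- All lists of length `N` with entries from the list `A`. -/
def listsOfLength {α : Type*} (A : List α) (N : ℕ) : List (List α) :=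
  Nat.rec [[]] (fun _ ih => A.flatMap fun a => ih.map (List.cons a)) N

theorem mem_listsOfLength {α : Type*} {A : List α} {N : ℕ} {l : List α} :
    l ∈ listsOfLength A N ↔ l.length = N ∧ ∀ x ∈ l, x ∈ A := by
  induction N generalizing l with
  | zero => simp +contextual [listsOfLength]
  | succ N ih =>
    have h : listsOfLength A (N + 1) =
      A.flatMap fun a => (listsOfLength A N).map (List.cons a) := rfl
    rw [h]
    cases l with
    | nil => simp
    | cons b l => simp [ih, and_left_comm]

theorem nodup_listsOfLength {α : Type*} {A : List α} (hA : A.Nodup) (N : ℕ) :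
    (listsOfLength A N).Nodup := by
  induction N with
  | zero => simp [listsOfLength]
  | succ N ih =>
    have h : listsOfLength A (N + 1) =
      A.flatMap fun a => (listsOfLength A N).map (List.cons a) := rfl
    rw [h, List.nodup_flatMap]
    refine ⟨fun a _ => ih.map List.cons_injective, hA.imp fun {a b} hab => ?_⟩
    rw [Function.onFun, List.disjoint_left]
    intro l hl hl'
    obtain ⟨_, _, rfl⟩ := List.mem_map.1 hl
    obtain ⟨_, _, h2⟩ := List.mem_map.1 hl'
    exact hab (List.cons.inj h2).1.symm

/-- All set systems of `m` sets over a universe of size `n`, with repetitions in the lists allowed, as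
lists of lists of numbers. -/
def allSystems (n m : ℕ) : List (List (List ℕ)) :=
  listsOfLength ((List.range (n + 1)).flatMap (listsOfLength (List.range n))) m

/-- The stream of a set system that is given as a list of lists of numbers. -/
def systemStream (m : ℕ) (S : List (List ℕ)) : List Item :=
  (List.range m).flatMap fun i => Sum.inl i :: (S.getD i []).map Sum.inr

/-- The number of elements covered by the sets whose IDs are listed in `J`. -/
def systemCoverage (n : ℕ) (S : List (List ℕ)) (J : List ℕ) : ℕ :=
  ((List.range n).filter fun e => ∃ i ∈ J, e ∈ S.getD i []).length

/-- The list `out` consists of the IDs of exactly `k` sets, and these cover at least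
`1 - (1 - 1 / k) ^ k - 1 / q` times as many elements as any `k` sets do, with all denominators
cleared. -/
def SystemSuccess (p : Params) (S : List (List ℕ)) (out : List ℕ) : Prop :=
  (∀ x ∈ out, x < p.2.1) ∧ ((List.range p.2.1).filter fun i => i ∈ out).length = p.2.2.1 ∧
    ∀ J ∈ listsOfLength (List.range p.2.1) p.2.2.1,
      p.2.2.2 * p.2.2.1 ^ p.2.2.1 * systemCoverage p.1 S J ≤
        p.2.2.2 * p.2.2.1 ^ p.2.2.1 * systemCoverage p.1 S out +
          (p.2.2.1 ^ p.2.2.1 + p.2.2.2 * (p.2.2.1 - 1) ^ p.2.2.1) * systemCoverage p.1 S J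

open Classical in
/-- The number of strings of random bits for which the machine fails on the set system `S`. -/
noncomputable def failureCount (a : ℕ) (p : Params) (G : Table) (S : List (List ℕ)) : ℕ :=
  ((listsOfLength [false, true] ((a + 1) * G.1)).filter fun r =>
    ¬ SystemSuccess p S (tableRun a p G (systemStream p.2.1 S) r)).length

/-- The machine solves maximum coverage for the parameters `p`, if these make sense: it fails with
probability at most `(m * n) ^ (-a)`, on every set system. -/
def TableGood (a : ℕ) (p : Params) (G : Table) : Prop :=
  (p.1 = 0 ∨ p.2.2.1 = 0 ∨ p.2.1 < p.2.2.1 ∨ p.2.2.2 = 0) ∨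
    p.2.1 * p.1 + 2 ≤ 2 ^ G.1 ∧ 2 ^ G.1 ≤ 2 * (p.2.1 * p.1 + 2) ∧
      ∀ S ∈ allSystems p.1 p.2.1,
        failureCount a p G S * (p.2.1 * p.1) ^ a ≤ 2 ^ ((a + 1) * G.1)

section Primrec

variable {α β : Type*} [Primcodable α] [Primcodable β]

theorem primrec_pow : Primrec₂ ((· ^ ·) : ℕ → ℕ → ℕ) :=
  Primrec₂.unpaired'.1 Nat.Primrec.pow

theorem primrec_listsOfLength {f : α → List β} {g : α → ℕ} (hf : Primrec f) (hg : Primrec g) :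
    Primrec fun x => listsOfLength (f x) (g x) := by
  refine Primrec.nat_rec' (f := g) (g := fun _ => [[]])
    (h := fun x y => (f x).flatMap fun b => y.2.map (List.cons b)) hg (Primrec.const _) ?_
  refine Primrec.list_flatMap (hf.comp Primrec.fst) ?_
  exact Primrec.list_map (Primrec.snd.comp (Primrec.snd.comp Primrec.fst))
    (Primrec.list_cons.comp (Primrec.snd.comp Primrec.fst) Primrec.snd)

theorem primrecRel_mem_list : PrimrecRel fun (b : β) (l : List β) => b ∈ l := by
  have h := (PrimrecRel.exists_mem_list (Primrec.eq (α := β))).swap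
  exact h.of_eq fun b l => by simp

theorem primrec_spaceBound (a : ℕ) {m q l : α → ℕ} (hm : Primrec m) (hq : Primrec q)
    (hl : Primrec l) : Primrec fun x => spaceBound a (m x) (q x) (l x) :=
  Primrec.nat_mul.comp (Primrec.nat_mul.comp (Primrec.nat_mul.comp (Primrec.const _) hm)
    (primrec_pow.comp hq (Primrec.const 2))) (primrec_pow.comp hl (Primrec.const 3))

variable {n m : α → ℕ} {p : α → Params} {G : α → Table} {S : α → List (List ℕ)}

theorem primrec_tableInit (a : ℕ) {r : α → List Bool} (hp : Primrec p) (hG : Primrec G)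
    (hr : Primrec r) : Primrec fun x => tableInit a (p x) (G x) (r x) :=
  Primrec.list_take.comp
    (primrec_spaceBound a (Primrec.fst.comp (Primrec.snd.comp hp))
      (Primrec.snd.comp (Primrec.snd.comp (Primrec.snd.comp hp))) (Primrec.fst.comp hG))
    ((Primrec.list_getD _).comp (Primrec.fst.comp (Primrec.snd.comp hG)) (Primrec.encode.comp hr))

theorem primrec_tableStep (a : ℕ) {w : α → List Bool} {i : α → Item} (hp : Primrec p)
    (hG : Primrec G) (hw : Primrec w) (hi : Primrec i) :
    Primrec fun x => tableStep a (p x) (G x) (w x) (i x) :=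
  Primrec.list_take.comp
    (primrec_spaceBound a (Primrec.fst.comp (Primrec.snd.comp hp))
      (Primrec.snd.comp (Primrec.snd.comp (Primrec.snd.comp hp))) (Primrec.fst.comp hG))
    ((Primrec.list_getD _).comp (Primrec.fst.comp (Primrec.snd.comp (Primrec.snd.comp hG)))
      (Primrec.encode.comp (hw.pair hi)))

theorem primrec_tableOutput {w : α → List Bool} (hG : Primrec G) (hw : Primrec w) :
    Primrec fun x => tableOutput (G x) (w x) :=
  (Primrec.list_getD _).comp (Primrec.snd.comp (Primrec.snd.comp (Primrec.snd.comp hG)))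
    (Primrec.encode.comp hw)

theorem primrec_tableRun (a : ℕ) {items : α → List Item} {r : α → List Bool} (hp : Primrec p)
    (hG : Primrec G) (hi : Primrec items) (hr : Primrec r) :
    Primrec fun x => tableRun a (p x) (G x) (items x) (r x) :=
  primrec_tableOutput hG <|
    Primrec.list_foldl (h := fun x y => tableStep a (p x) (G x) y.1 y.2) hi
      (primrec_tableInit a hp hG hr)
      (primrec_tableStep a (hp.comp Primrec.fst) (hG.comp Primrec.fst)
        (Primrec.fst.comp Primrec.snd) (Primrec.snd.comp Primrec.snd))

theorem primrec_allSystems (hn : Primrec n) (hm : Primrec m) :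
    Primrec fun x => allSystems (n x) (m x) :=
  primrec_listsOfLength
    (Primrec.list_flatMap (Primrec.list_range.comp (Primrec.succ.comp hn))
      (primrec_listsOfLength (Primrec.list_range.comp (hn.comp Primrec.fst)) Primrec.snd)) hm

theorem primrec_systemStream (hm : Primrec m) (hS : Primrec S) :
    Primrec fun x => systemStream (m x) (S x) :=
  Primrec.list_flatMap (Primrec.list_range.comp hm)
    (Primrec.list_cons.comp (Primrec.sumInl.comp Primrec.snd)
      (Primrec.list_map ((Primrec.list_getD _).comp (hS.comp Primrec.fst) Primrec.snd)
        (Primrec.sumInr.comp Primrec.snd)))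

theorem primrec_systemCoverage {J : α → List ℕ} (hn : Primrec n) (hS : Primrec S)
    (hJ : Primrec J) : Primrec fun x => systemCoverage (n x) (S x) (J x) := by
  have h1 : PrimrecRel fun (i : ℕ) (y : ℕ × List (List ℕ)) => y.1 ∈ y.2.getD i [] :=
    primrecRel_mem_list.comp (Primrec.fst.comp Primrec.snd)
      ((Primrec.list_getD _).comp (Primrec.snd.comp Primrec.snd) Primrec.fst)
  have h2 : PrimrecRel fun (e : ℕ) (y : List ℕ × List (List ℕ)) =>
      ∃ i ∈ y.1, e ∈ y.2.getD i [] :=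
    h1.exists_mem_list.comp (Primrec.fst.comp Primrec.snd)
      (Primrec.fst.pair (Primrec.snd.comp Primrec.snd))
  exact Primrec.list_length.comp (h2.listFilter.comp (Primrec.list_range.comp hn) (hJ.pair hS))

theorem primrecPred_systemSuccess {out : α → List ℕ} (hp : Primrec p) (hS : Primrec S)
    (hout : Primrec out) : PrimrecPred fun x => SystemSuccess (p x) (S x) (out x) := by
  have hm : Primrec fun x => (p x).2.1 := Primrec.fst.comp (Primrec.snd.comp hp)
  have hk : Primrec fun x => (p x).2.2.1 :=
    Primrec.fst.comp (Primrec.snd.comp (Primrec.snd.comp hp))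
  have hkk : Primrec fun p : Params => p.2.2.1 :=
    Primrec.fst.comp (Primrec.snd.comp Primrec.snd)
  have hqq : Primrec fun p : Params => p.2.2.2 :=
    Primrec.snd.comp (Primrec.snd.comp Primrec.snd)
  refine ((Primrec.nat_lt.forall_mem_list).comp hout hm).and
    ((Primrec.eq.comp (Primrec.list_length.comp
      (primrecRel_mem_list.listFilter.comp (Primrec.list_range.comp hm) hout)) hk).and ?_)
  have h1 : PrimrecRel fun (J : List ℕ) (y : Params × List (List ℕ) × List ℕ) =>
      y.1.2.2.2 * y.1.2.2.1 ^ y.1.2.2.1 * systemCoverage y.1.1 y.2.1 J ≤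
        y.1.2.2.2 * y.1.2.2.1 ^ y.1.2.2.1 * systemCoverage y.1.1 y.2.1 y.2.2 +
          (y.1.2.2.1 ^ y.1.2.2.1 + y.1.2.2.2 * (y.1.2.2.1 - 1) ^ y.1.2.2.1) *
            systemCoverage y.1.1 y.2.1 J := by
    have hP : Primrec fun z : List ℕ × Params × List (List ℕ) × List ℕ => z.2.1 :=
      Primrec.fst.comp Primrec.snd
    have hT : Primrec fun z : List ℕ × Params × List (List ℕ) × List ℕ => z.2.2.1 :=
      Primrec.fst.comp (Primrec.snd.comp Primrec.snd)
    have ho : Primrec fun z : List ℕ × Params × List (List ℕ) × List ℕ => z.2.2.2 :=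
      Primrec.snd.comp (Primrec.snd.comp Primrec.snd)
    have hn' := Primrec.fst.comp hP
    have hk' := hkk.comp hP
    have hq' := hqq.comp hP
    have hpow := primrec_pow.comp hk' hk'
    have hcJ := primrec_systemCoverage hn' hT Primrec.fst
    exact Primrec.nat_le.comp (Primrec.nat_mul.comp (Primrec.nat_mul.comp hq' hpow) hcJ)
      (Primrec.nat_add.comp
        (Primrec.nat_mul.comp (Primrec.nat_mul.comp hq' hpow) (primrec_systemCoverage hn' hT ho))
        (Primrec.nat_mul.comp (Primrec.nat_add.comp hpow (Primrec.nat_mul.comp hq'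
          (primrec_pow.comp (Primrec.nat_sub.comp hk' (Primrec.const 1)) hk'))) hcJ))
  exact h1.forall_mem_list.comp (primrec_listsOfLength (Primrec.list_range.comp hm) hk)
    (hp.pair (hS.pair hout))

theorem primrec_failureCount (a : ℕ) (hp : Primrec p) (hG : Primrec G) (hS : Primrec S) :
    Primrec fun x => failureCount a (p x) (G x) (S x) := by
  classical
  have h1 : PrimrecRel fun (r : List Bool) (y : Params × Table × List (List ℕ)) =>
      ¬ SystemSuccess y.1 y.2.2 (tableRun a y.1 y.2.1 (systemStream y.1.2.1 y.2.2) r) := by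
    have hP : Primrec fun z : List Bool × Params × Table × List (List ℕ) => z.2.1 :=
      Primrec.fst.comp Primrec.snd
    have hT : Primrec fun z : List Bool × Params × Table × List (List ℕ) => z.2.2.2 :=
      Primrec.snd.comp (Primrec.snd.comp Primrec.snd)
    exact (primrecPred_systemSuccess hP hT (primrec_tableRun a hP
      (Primrec.fst.comp (Primrec.snd.comp Primrec.snd))
      (primrec_systemStream (Primrec.fst.comp (Primrec.snd.comp hP)) hT) Primrec.fst)).not
  exact Primrec.list_length.comp (h1.listFilter.comp
    (primrec_listsOfLength (Primrec.const _)
      (Primrec.nat_mul.comp (Primrec.const _) (Primrec.fst.comp hG))) (hp.pair (hG.pair hS)))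

theorem primrecRel_tableGood (a : ℕ) : PrimrecRel (TableGood a) := by
  have hn : Primrec fun x : Params × Table => x.1.1 := Primrec.fst.comp Primrec.fst
  have hm : Primrec fun x : Params × Table => x.1.2.1 :=
    Primrec.fst.comp (Primrec.snd.comp Primrec.fst)
  have hk : Primrec fun x : Params × Table => x.1.2.2.1 :=
    Primrec.fst.comp (Primrec.snd.comp (Primrec.snd.comp Primrec.fst))
  have hq : Primrec fun x : Params × Table => x.1.2.2.2 :=
    Primrec.snd.comp (Primrec.snd.comp (Primrec.snd.comp Primrec.fst))
  have hl : Primrec fun x : Params × Table => x.2.1 := Primrec.fst.comp Primrec.snd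
  have hmn := Primrec.nat_mul.comp hm hn
  have hmn2 := Primrec.nat_add.comp hmn (Primrec.const 2)
  have h2l := primrec_pow.comp (Primrec.const 2) hl
  have h1 : PrimrecRel fun (S : List (List ℕ)) (x : Params × Table) =>
      failureCount a x.1 x.2 S * (x.1.2.1 * x.1.1) ^ a ≤ 2 ^ ((a + 1) * x.2.1) := by
    exact Primrec.nat_le.comp
      (Primrec.nat_mul.comp (primrec_failureCount a (Primrec.fst.comp Primrec.snd)
        (Primrec.snd.comp Primrec.snd) Primrec.fst)
        (primrec_pow.comp (hmn.comp Primrec.snd) (Primrec.const a)))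
      (primrec_pow.comp (Primrec.const 2)
        (Primrec.nat_mul.comp (Primrec.const (a + 1)) (hl.comp Primrec.snd)))
  have h2 : PrimrecPred fun x : Params × Table => TableGood a x.1 x.2 :=
    ((Primrec.eq.comp hn (Primrec.const 0)).or ((Primrec.eq.comp hk (Primrec.const 0)).or
      ((Primrec.nat_lt.comp hm hk).or (Primrec.eq.comp hq (Primrec.const 0))))).or
    ((Primrec.nat_le.comp hmn2 h2l).and
      ((Primrec.nat_le.comp h2l (Primrec.nat_mul.comp (Primrec.const 2) hmn2)).and
        (h1.forall_mem_list.comp (primrec_allSystems hn hm) Primrec.id)))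
  exact h2

/-- Exhaustive search: a decidable relation in which every `x` is related to some `y` contains the
graph of a computable function. -/
theorem exists_computable_choice {R : α → β → Prop} (hR : PrimrecRel R) (hex : ∀ x, ∃ y, R x y) :
    ∃ g : α → β, Computable g ∧ ∀ x, R x (g x) := by
  classical
  let f : α → ℕ → Option β := fun x c => (Encodable.decode c).bind fun y => Option.guard (R x) y
  have hf : Primrec₂ f := by
    refine Primrec.option_bind (Primrec.decode.comp Primrec.snd) ?_
    exact Primrec.option_guard (p := fun (z : (α × ℕ) × β) y => R z.1.1 y)
      (hR.comp (Primrec.fst.comp (Primrec.fst.comp Primrec.fst)) Primrec.snd) Primrec.snd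
  have hdom : ∀ x, (Nat.rfindOpt (f x)).Dom := by
    intro x
    obtain ⟨y, hy⟩ := hex x
    refine Nat.rfindOpt_dom.2 ⟨Encodable.encode y, y, ?_⟩
    simp [f, Option.guard, hy]
  refine ⟨fun x => (Nat.rfindOpt (f x)).get (hdom x), ?_, fun x => ?_⟩
  · exact (Partrec.rfindOpt hf.to_comp).of_eq fun x => (Part.some_get (hdom x)).symm
  · obtain ⟨c, hc⟩ := Nat.rfindOpt_spec (Part.get_mem (hdom x))
    obtain ⟨y, -, hy⟩ := Option.bind_eq_some_iff.1 hc
    obtain ⟨rfl, h⟩ := Option.guard_eq_some_iff.1 hy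
    simpa using h

end Primrec

/-! ### The test is correct and some machine passes it -/

section Bridge

variable {n m : ℕ}

/-- A set system as a list of lists of numbers. -/
def systemOf (S : Fin m → List (Fin n)) : List (List ℕ) :=
  List.ofFn fun i => (S i).map Fin.val

theorem systemOf_getD (S : Fin m → List (Fin n)) (i : Fin m) :
    (systemOf S).getD i.val [] = (S i).map Fin.val := by
  simp [systemOf, List.getD]

theorem systemStream_systemOf (S : Fin m → List (Fin n)) :
    systemStream m (systemOf S) = stream S := by
  unfold systemStream stream
  rw [← List.map_coe_finRange_eq_range, List.flatMap_map]
  congr 1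
  funext i
  rw [systemOf_getD, List.map_map]
  rfl

theorem systemOf_mem_allSystems {S : Fin m → List (Fin n)} (hS : ∀ i, (S i).Nodup) :
    systemOf S ∈ allSystems n m := by
  refine mem_listsOfLength.2 ⟨by simp [systemOf], fun x hx => ?_⟩
  obtain ⟨i, rfl⟩ := List.mem_ofFn.1 hx
  refine List.mem_flatMap.2 ⟨(S i).length, ?_, ?_⟩
  · have := (hS i).length_le_card
    rw [Fintype.card_fin] at this
    exact List.mem_range.2 (Nat.lt_succ_of_le this)
  · refine mem_listsOfLength.2 ⟨by simp, fun e he => ?_⟩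
    obtain ⟨e', -, rfl⟩ := List.mem_map.1 he
    exact List.mem_range.2 e'.2

theorem exists_eq_systemOf {T : List (List ℕ)} (hT : T ∈ allSystems n m) :
    ∃ S : Fin m → List (Fin n), T = systemOf S := by
  obtain ⟨rfl, h⟩ := mem_listsOfLength.1 hT
  have h2 : ∀ l ∈ T, ∀ e ∈ l, e < n := by
    intro l hl e he
    obtain ⟨N, -, hN⟩ := List.mem_flatMap.1 (h l hl)
    exact List.mem_range.1 ((mem_listsOfLength.1 hN).2 e he)
  refine ⟨fun i => (T.get i).pmap Fin.mk (h2 _ (List.get_mem T i)), ?_⟩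
  unfold systemOf
  simp [List.map_pmap]

theorem systemCoverage_systemOf (S : Fin m → List (Fin n)) {J : List ℕ} {I : Finset (Fin m)}
    (h : J.toFinset = I.map Fin.valEmbedding) :
    systemCoverage n (systemOf S) J = coverage S I := by
  have hJ : ∀ x, x ∈ J ↔ ∃ i ∈ I, i.val = x := by
    intro x
    rw [← List.mem_toFinset, h]
    simp
  have h1 : systemCoverage n (systemOf S) J =
      ((Finset.range n).filter fun e => ∃ i ∈ J, e ∈ (systemOf S).getD i []).card := rfl
  rw [h1, coverage, ← Finset.card_map Fin.valEmbedding]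
  congr 1
  ext e
  simp only [Finset.mem_filter, Finset.mem_range, Finset.mem_map, Finset.mem_biUnion,
    List.mem_toFinset, Fin.valEmbedding_apply]
  constructor
  · rintro ⟨-, x, hx, he⟩
    obtain ⟨i, hi, rfl⟩ := (hJ x).1 hx
    rw [systemOf_getD] at he
    obtain ⟨e', he', rfl⟩ := List.mem_map.1 he
    exact ⟨e', ⟨i, hi, he'⟩, rfl⟩
  · rintro ⟨e', ⟨i, hi, he'⟩, rfl⟩
    refine ⟨e'.2, i.val, (hJ _).2 ⟨i, hi, rfl⟩, ?_⟩
    rw [systemOf_getD]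
    exact List.mem_map.2 ⟨e', he', rfl⟩

/-- The approximation guarantee with all denominators cleared. -/
theorem mul_le_iff_clear_denominators {k q : ℕ} (hk : 0 < k) (hq : 0 < q) (c d : ℕ) :
    (1 - (1 - 1 / (k : ℝ)) ^ k - 1 / q) * c ≤ d ↔
      q * k ^ k * c ≤ q * k ^ k * d + (k ^ k + q * (k - 1) ^ k) * c := by
  have hk' : (0 : ℝ) < k := by exact_mod_cast hk
  have hq' : (0 : ℝ) < q := by exact_mod_cast hq
  have h1 : ((k - 1 : ℕ) : ℝ) ^ k = (1 - 1 / (k : ℝ)) ^ k * (k : ℝ) ^ k := by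
    rw [← mul_pow, Nat.cast_sub hk, sub_mul, one_div_mul_cancel hk'.ne', one_mul, Nat.cast_one]
  have h2 : q * k ^ k * c ≤ q * k ^ k * d + (k ^ k + q * (k - 1) ^ k) * c ↔
      ((q : ℝ) * k ^ k) * ((1 - (1 - 1 / (k : ℝ)) ^ k - 1 / q) * c) ≤ ((q : ℝ) * k ^ k) * d := by
    rw [← Nat.cast_le (α := ℝ)]
    push_cast
    rw [h1]
    have h3 : ((q : ℝ) * k ^ k) * ((1 - (1 - 1 / (k : ℝ)) ^ k - 1 / q) * c) =
        q * k ^ k * c - (k ^ k + q * ((1 - 1 / (k : ℝ)) ^ k * k ^ k)) * c := by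
      field_simp
      ring
    rw [h3, sub_le_iff_le_add]
  rw [h2, mul_le_mul_iff_right₀ (by positivity)]

theorem systemSuccess_systemOf_iff {k q : ℕ} (hk : 0 < k) (hkm : k ≤ m) (hq : 0 < q)
    (S : Fin m → List (Fin n)) (out : List ℕ) :
    SystemSuccess (n, m, k, q) (systemOf S) out ↔
      IsApproxSolution S k (1 - (1 - 1 / (k : ℝ)) ^ k - 1 / q) out := by
  have hcount : ((List.range m).filter fun i => i ∈ out).length =
      ((Finset.range m).filter fun i => i ∈ out).card := rfl
  constructor
  · rintro ⟨h1, h2, h3⟩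
    dsimp only at h1 h2 h3
    set I : Finset (Fin m) := Finset.univ.filter fun i => i.val ∈ out with hI
    have hIout : out.toFinset = I.map Fin.valEmbedding := by
      ext x
      simp only [hI, List.mem_toFinset, Finset.mem_map, Finset.mem_filter, Finset.mem_univ, true_and,
        Fin.valEmbedding_apply]
      exact ⟨fun hx => ⟨⟨x, h1 x hx⟩, hx, rfl⟩, by rintro ⟨i, hi, rfl⟩; exact hi⟩
    have hIk : I.card = k := by
      rw [← h2, hcount, ← Finset.card_map Fin.valEmbedding, ← hIout]
      congr 1
      ext x
      simp only [List.mem_toFinset, Finset.mem_filter, Finset.mem_range]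
      exact ⟨fun hx => ⟨h1 x hx, hx⟩, fun hx => hx.2⟩
    refine ⟨I, hIk, hIout, ?_⟩
    obtain ⟨O, hO, hOc⟩ := exists_card_biUnion_eq_maxCover (fun i => (S i).toFinset) (k := k)
      (by simpa using hkm)
    have h4 := h3 (O.toList.map Fin.val) (mem_listsOfLength.2 ⟨by simp [hO], by simp⟩)
    rw [systemCoverage_systemOf S hIout, systemCoverage_systemOf S (I := O) (by ext x; simp)] at h4
    have h5 : coverage S O = opt S k := hOc
    rw [h5] at h4
    exact (mul_le_iff_clear_denominators hk hq _ _).2 h4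
  · rintro ⟨I, hIk, hIout, h⟩
    have hmem : ∀ x, x ∈ out ↔ ∃ i ∈ I, i.val = x := by
      intro x
      rw [← List.mem_toFinset, hIout]
      simp
    have hlt : ∀ x ∈ out, x < m := by
      intro x hx
      obtain ⟨i, -, rfl⟩ := (hmem x).1 hx
      exact i.2
    refine ⟨hlt, ?_, fun J hJ => ?_⟩
    · dsimp only
      rw [hcount, ← hIk, ← Finset.card_map Fin.valEmbedding, ← hIout]
      congr 1
      ext x
      simp only [List.mem_toFinset, Finset.mem_filter, Finset.mem_range]
      exact ⟨fun hx => hx.2, fun hx => ⟨hlt x hx, hx⟩⟩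
    · dsimp only at hJ ⊢
      obtain ⟨hJk, hJm⟩ := mem_listsOfLength.1 hJ
      set O : Finset (Fin m) := Finset.univ.filter fun i => i.val ∈ J with hO
      have hOJ : J.toFinset = O.map Fin.valEmbedding := by
        ext x
        simp only [hO, List.mem_toFinset, Finset.mem_map, Finset.mem_filter, Finset.mem_univ,
          true_and, Fin.valEmbedding_apply]
        exact ⟨fun hx => ⟨⟨x, List.mem_range.1 (hJm x hx)⟩, hx, rfl⟩,
          by rintro ⟨i, hi, rfl⟩; exact hi⟩
      have hOk : O.card ≤ k := by
        rw [← Finset.card_map Fin.valEmbedding, ← hOJ, ← hJk]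
        exact List.toFinset_card_le J
      rw [systemCoverage_systemOf S hIout, systemCoverage_systemOf S hOJ]
      have h4 : coverage S O ≤ opt S k :=
        card_biUnion_le_maxCover_of_card_le (fun i => (S i).toFinset) (by simpa using hkm) hOk
      rw [← mul_le_iff_clear_denominators hk hq]
      rcases le_total 0 (1 - (1 - 1 / (k : ℝ)) ^ k - 1 / q) with h0 | h0
      · exact (mul_le_mul_of_nonneg_left (by exact_mod_cast h4) h0).trans h
      · exact (mul_nonpos_of_nonpos_of_nonneg h0 (Nat.cast_nonneg _)).trans (Nat.cast_nonneg _)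

theorem length_filter_listsOfLength (t : ℕ) (P : List Bool → Prop) [DecidablePred P] :
    ((listsOfLength [false, true] t).filter fun r => P r).length =
      (Finset.univ.filter fun r : Fin t → Bool => P (List.ofFn r)).card := by
  have hnd : ((listsOfLength [false, true] t).filter fun r => P r).Nodup :=
    (nodup_listsOfLength (by simp) t).filter _
  rw [← List.toFinset_card_of_nodup hnd, ← Finset.card_image_of_injective _ List.ofFn_injective]
  congr 1
  ext l
  simp only [List.mem_toFinset, List.mem_filter, mem_listsOfLength, Finset.mem_image,
    Finset.mem_filter, Finset.mem_univ, true_and, decide_eq_true_eq]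
  constructor
  · rintro ⟨⟨rfl, -⟩, hP⟩
    exact ⟨l.get, by rwa [List.ofFn_get], List.ofFn_get l⟩
  · rintro ⟨r, hP, rfl⟩
    exact ⟨⟨by simp, by simp⟩, hP⟩

open Classical in
theorem failureCount_systemOf (a : ℕ) {k q : ℕ} (hk : 0 < k) (hkm : k ≤ m) (hq : 0 < q) (G : Table)
    (S : Fin m → List (Fin n)) :
    failureCount a (n, m, k, q) G (systemOf S) =
      (Finset.univ.filter fun r : Fin ((a + 1) * G.1) → Bool =>
        ¬ IsApproxSolution S k (1 - (1 - 1 / (k : ℝ)) ^ k - 1 / q)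
          (tableRun a (n, m, k, q) G (stream S) (List.ofFn r))).card := by
  unfold failureCount
  rw [length_filter_listsOfLength _ fun r => ¬ SystemSuccess _ _ _]
  simp_rw [systemSuccess_systemOf_iff hk hkm hq, systemStream_systemOf]

end Bridge

section Tabulate

/-- The table of the values of `f` at the arguments with codes below `N`. -/
def tabulate {α β : Type*} [Encodable α] (N : ℕ) (f : α → List β) : List (List β) :=
  (List.range N).map fun c => ((Encodable.decode c).map f).getD []

theorem tabulate_getD {α β : Type*} [Encodable α] {N : ℕ} (f : α → List β) {x : α}
    (hx : Encodable.encode x < N) : (tabulate N f).getD (Encodable.encode x) [] = f x := by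
  simp [tabulate, List.getD, hx]

theorem exists_encode_lt {α : Type*} [Encodable α] {s : Set α} (hs : s.Finite) :
    ∃ N, ∀ x ∈ s, Encodable.encode x < N := by
  obtain ⟨N, hN⟩ := (hs.image Encodable.encode).bddAbove
  exact ⟨N + 1, fun x hx => Nat.lt_succ_of_le (hN ⟨x, hx, rfl⟩)⟩

theorem mem_stream_lt {n m : ℕ} (S : Fin m → List (Fin n)) {x : Item} (hx : x ∈ stream S) :
    x ∈ Sum.inl '' (Set.Iio m) ∪ Sum.inr '' (Set.Iio n) := by
  obtain ⟨i, -, hx⟩ := List.mem_flatMap.1 hx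
  rcases List.mem_cons.1 hx with rfl | hx
  · exact Or.inl ⟨i, i.2, rfl⟩
  · obtain ⟨e, -, rfl⟩ := List.mem_map.1 hx
    exact Or.inr ⟨e, e.2, rfl⟩

theorem exists_tableGood (a : ℕ) (p : Params) : ∃ G, TableGood a p G := by
  classical
  obtain ⟨n, m, k, q⟩ := p
  by_cases hp : n = 0 ∨ k = 0 ∨ m < k ∨ q = 0
  · exact ⟨default, Or.inl hp⟩
  push Not at hp
  obtain ⟨hn, hk, hkm, hq⟩ := hp
  have hk := Nat.pos_of_ne_zero hk
  have hq := Nat.pos_of_ne_zero hq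
  set l := Nat.log 2 (m * n + 2) + 1 with hl
  have hl1 : m * n + 2 ≤ 2 ^ l := (Nat.lt_pow_succ_log_self (by norm_num) _).le
  have hl2 : 2 ^ l ≤ 2 * (m * n + 2) := by
    rw [hl, pow_succ, mul_comm]
    exact Nat.mul_le_mul_left 2 (Nat.pow_log_le_self 2 (by omega))
  obtain ⟨init, step, output, hinit, hstep, hgood⟩ :=
    exists_machine a (Nat.pos_of_ne_zero hn) hk hkm hq hl1
  set s := spaceBound a m q l with hs
  have hfin : {w : List Bool | w.length ≤ max s ((a + 1) * l)}.Finite := List.finite_length_le Bool _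
  have hfinItem : (Sum.inl '' (Set.Iio m) ∪ Sum.inr '' (Set.Iio n) : Set Item).Finite :=
    ((Set.finite_Iio m).image _).union ((Set.finite_Iio n).image _)
  obtain ⟨N₁, hN₁⟩ := exists_encode_lt hfin
  obtain ⟨N₂, hN₂⟩ := exists_encode_lt (hfin.prod hfinItem)
  let G : Table := (l, tabulate N₁ init, tabulate N₂ fun x : List Bool × Item => step x.1 x.2,
    tabulate N₁ output)
  have hG1 : ∀ r : Fin ((a + 1) * l) → Bool,
      tableInit a (n, m, k, q) G (List.ofFn r) = init (List.ofFn r) := by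
    intro r
    have h : (tabulate N₁ init).getD (Encodable.encode (List.ofFn r)) [] = init (List.ofFn r) :=
      tabulate_getD init (hN₁ _ (le_max_of_le_right List.length_ofFn.le))
    exact (congrArg (List.take s) h).trans (List.take_of_length_le (hinit _))
  have hG2 : ∀ w : List Bool, w.length ≤ s → ∀ x ∈ Sum.inl '' (Set.Iio m) ∪ Sum.inr '' (Set.Iio n),
      tableStep a (n, m, k, q) G w x = step w x := by
    intro w hw x hx
    have h : (tabulate N₂ fun x : List Bool × Item => step x.1 x.2).getD
        (Encodable.encode (w, x)) [] = step w x :=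
      tabulate_getD (fun x : List Bool × Item => step x.1 x.2)
        (hN₂ (w, x) ⟨le_max_of_le_left hw, hx⟩)
    exact (congrArg (List.take s) h).trans (List.take_of_length_le (hstep _ _))
  have hfold : ∀ items : List Item,
      (∀ x ∈ items, x ∈ Sum.inl '' (Set.Iio m) ∪ Sum.inr '' (Set.Iio n)) →
      ∀ w : List Bool, w.length ≤ s →
        items.foldl (tableStep a (n, m, k, q) G) w = items.foldl step w ∧
          (items.foldl step w).length ≤ s := by
    intro items
    induction items with
    | nil => exact fun _ w hw => ⟨rfl, hw⟩
    | cons x items ih =>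
      intro hitems w hw
      rw [List.foldl_cons, List.foldl_cons, hG2 w hw x (hitems x (by simp))]
      exact ih (fun y hy => hitems y (List.mem_cons_of_mem _ hy)) _ (hstep _ _)
  refine ⟨G, Or.inr ⟨hl1, hl2, fun T hT => ?_⟩⟩
  obtain ⟨S, rfl⟩ := exists_eq_systemOf hT
  rw [failureCount_systemOf a hk hkm hq]
  have hrun : ∀ r : Fin ((a + 1) * l) → Bool, tableRun a (n, m, k, q) G (stream S) (List.ofFn r) =
      output ((stream S).foldl step (init (List.ofFn r))) := by
    intro r
    obtain ⟨h1, h2⟩ := hfold (stream S) (fun x hx => mem_stream_lt S hx) _ (hinit (List.ofFn r))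
    unfold tableRun
    rw [hG1, h1]
    exact tabulate_getD output (hN₁ _ (le_max_of_le_left h2))
  have hcount := hgood S
  simp_rw [← hrun] at hcount
  exact hcount

end Tabulate

/-! ### The streaming algorithm found by exhaustive search -/

section Algorithm

/-- Data `g (u x)` that are computed from a part of the input may be used as a further input. -/
theorem computable_of_choice {α β γ σ : Type*} [Primcodable α] [Primcodable β] [Primcodable γ]
    [Primcodable σ] {F : α → γ → σ} (hF : Computable fun y : α × γ => F y.1 y.2) {g : β → γ}
    (hg : Computable g) {u : α → β} (hu : Computable u) : Computable fun x => F x (g (u x)) :=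
  hF.comp (Computable.id.pair (hg.comp hu))

theorem computable_coins_of_choice (a : ℕ) {g : Params → Table} (hg : Computable g) :
    Computable fun p => (a + 1) * (g p).1 := by
  have h : Primrec fun G : Table => (a + 1) * G.1 :=
    Primrec.nat_mul.comp (Primrec.const (a + 1)) Primrec.fst
  exact h.to_comp.comp hg

theorem computable_init_of_choice (a : ℕ) {g : Params → Table} (hg : Computable g) :
    Computable fun x : Params × List Bool => tableInit a x.1 (g x.1) x.2 := by
  have h : Primrec fun y : (Params × List Bool) × Table => tableInit a y.1.1 y.2 y.1.2 :=
    primrec_tableInit a (Primrec.fst.comp Primrec.fst) Primrec.snd (Primrec.snd.comp Primrec.fst)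
  exact computable_of_choice (F := fun (x : Params × List Bool) G => tableInit a x.1 G x.2)
    h.to_comp hg Computable.fst

theorem computable_step_of_choice (a : ℕ) {g : Params → Table} (hg : Computable g) :
    Computable fun x : Params × List Bool × Item × List Bool =>
      tableStep a x.1 (g x.1) x.2.1 x.2.2.1 := by
  have h : Primrec fun y : (Params × List Bool × Item × List Bool) × Table =>
      tableStep a y.1.1 y.2 y.1.2.1 y.1.2.2.1 :=
    primrec_tableStep a (Primrec.fst.comp Primrec.fst) Primrec.snd
      (Primrec.fst.comp (Primrec.snd.comp Primrec.fst))
      (Primrec.fst.comp (Primrec.snd.comp (Primrec.snd.comp Primrec.fst)))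
  exact computable_of_choice
    (F := fun (x : Params × List Bool × Item × List Bool) G => tableStep a x.1 G x.2.1 x.2.2.1)
    h.to_comp hg Computable.fst

theorem computable_output_of_choice {g : Params → Table} (hg : Computable g) :
    Computable fun x : Params × List Bool => tableOutput (g x.1) x.2 := by
  have h : Primrec fun y : (Params × List Bool) × Table => tableOutput y.2 y.1.2 :=
    primrec_tableOutput Primrec.snd (Primrec.snd.comp Primrec.fst)
  exact computable_of_choice (F := fun (x : Params × List Bool) G => tableOutput G x.2)
    h.to_comp hg Computable.fst

/-- The streaming algorithm that runs the machine `g p` for the parameters `p`. Random bits are used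
at the start only. -/
def tableAlg (a : ℕ) (g : Params → Table) (hg : Computable g) : StreamAlg where
  coins p := (a + 1) * (g p).1
  init x := tableInit a x.1 (g x.1) x.2
  step x := tableStep a x.1 (g x.1) x.2.1 x.2.2.1
  output x := tableOutput (g x.1) x.2
  computable_coins := computable_coins_of_choice a hg
  computable_init := computable_init_of_choice a hg
  computable_step := computable_step_of_choice a hg
  computable_output := computable_output_of_choice hg

variable (a : ℕ) (g : Params → Table) (hg : Computable g) (p : Params)

theorem tableAlg_memory (items : List Item) :
    (tableAlg a g hg).memory p items = (fairCoins ((a + 1) * (g p).1)).map fun r =>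
      items.foldl (tableStep a p (g p)) (tableInit a p (g p) r) := by
  induction items using List.reverseRecOn with
  | nil => rfl
  | append_singleton items x ih =>
    have h : (tableAlg a g hg).memory p (items ++ [x]) =
        ((tableAlg a g hg).memory p items).bind fun w =>
          (fairCoins ((a + 1) * (g p).1)).map
            (Function.const _ (tableStep a p (g p) w x)) := by
      simp only [StreamAlg.memory, List.foldl_append, List.foldl_cons, List.foldl_nil]
      rfl
    rw [h, ih]
    simp_rw [PMF.map_const]
    rw [PMF.bind_map, ← PMF.bind_pure_comp]
    congr 1
    funext r
    simp

theorem length_foldl_tableStep_le (G : Table) (items : List Item) (r : List Bool) :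
    (items.foldl (tableStep a p G) (tableInit a p G r)).length ≤
      spaceBound a p.2.1 p.2.2.2 G.1 := by
  induction items using List.reverseRecOn with
  | nil => exact List.length_take_le _ _
  | append_singleton items x ih =>
    rw [List.foldl_append]
    exact List.length_take_le _ _

theorem tableAlg_usesSpaceAtMost (items : List Item) {s : ℝ}
    (hs : (spaceBound a p.2.1 p.2.2.2 (g p).1 : ℝ) ≤ s) :
    (tableAlg a g hg).UsesSpaceAtMost p items s := by
  intro l _ w hw
  rw [tableAlg_memory, PMF.mem_support_map_iff] at hw
  obtain ⟨r, -, rfl⟩ := hw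
  exact le_trans (by exact_mod_cast length_foldl_tableStep_le a p (g p) l r) hs

open Classical in
theorem tableAlg_result_apply (items : List Item) (E : Set (List ℕ)) :
    ((tableAlg a g hg).result p items).toOuterMeasure E =
      ((Finset.univ.filter fun r : Fin ((a + 1) * (g p).1) → Bool =>
        tableRun a p (g p) items (List.ofFn r) ∈ E).card : ℝ≥0∞) /
          (2 ^ ((a + 1) * (g p).1) : ℕ) := by
  rw [StreamAlg.result, tableAlg_memory, fairCoins, PMF.map_comp, PMF.map_comp,
    PMF.toOuterMeasure_map_apply, PMF.toOuterMeasure_uniformOfFintype_apply, Fintype.card_fun,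
    Fintype.card_bool, Fintype.card_fin, ← Set.toFinset_card]
  congr 3
  ext r
  simp only [Set.mem_toFinset, Finset.mem_filter, Finset.mem_univ, true_and]
  rfl

end Algorithm

/-- The memory granted for the accuracy `1 / ⌈1 / ε⌉` is `Õ(m / ε ^ 2)`. -/
theorem spaceBound_le (a : ℕ) {n m l : ℕ} {ε : ℝ} (hn : 0 < n) (hm : 0 < m) (hε0 : 0 < ε)
    (hε : ε < 1) (hl : 2 ^ l ≤ 2 * (m * n + 2)) :
    (spaceBound a m ⌈1 / ε⌉₊ l : ℝ) ≤
      (1027 * (a + 4) * 256 : ℝ) * (m / ε ^ 2) * Real.log ((m : ℝ) * n + 2) ^ 3 := by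
  have hq : (⌈1 / ε⌉₊ : ℝ) ≤ 2 / ε := by
    have h1 := (Nat.ceil_lt_add_one (a := 1 / ε) (by positivity)).le
    have h2 : 1 ≤ 1 / ε := by rw [le_div_iff₀ hε0]; linarith
    have h3 : 2 / ε = 1 / ε + 1 / ε := by ring
    linarith
  have hmn : (1 : ℝ) ≤ (m : ℝ) * n := by exact_mod_cast Nat.mul_pos hm hn
  set x : ℝ := (m : ℝ) * n + 2 with hx
  have hlog2 : Real.log 2 ≤ Real.log x := Real.log_le_log (by norm_num) (by linarith)
  have hl4 : (l : ℝ) ≤ 4 * Real.log x := by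
    have h1 : (2 : ℝ) ^ l ≤ 2 * x := by
      rw [hx]
      exact_mod_cast hl
    have h2 := Real.log_le_log (by positivity) h1
    rw [Real.log_pow, Real.log_mul (by norm_num) (by linarith)] at h2
    have h3 := Real.log_two_gt_d9
    have h4 : (l : ℝ) * (1 / 2) ≤ l * Real.log 2 :=
      mul_le_mul_of_nonneg_left (by linarith) (Nat.cast_nonneg l)
    linarith
  have h5 : (spaceBound a m ⌈1 / ε⌉₊ l : ℝ) ≤
      1027 * (a + 4) * m * (2 / ε) ^ 2 * (4 * Real.log x) ^ 3 := by
    unfold spaceBound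
    push_cast
    gcongr
  refine h5.trans_eq ?_
  ring

theorem IsApproxSolution.mono {n m : ℕ} {S : Fin m → List (Fin n)} {k : ℕ} {α α' : ℝ}
    (h : α' ≤ α) {out : List ℕ} (hout : IsApproxSolution S k α out) :
    IsApproxSolution S k α' out := by
  obtain ⟨I, hI, hIout, hc⟩ := hout
  exact ⟨I, hI, hIout, (mul_le_mul_of_nonneg_right h (Nat.cast_nonneg _)).trans hc⟩

/-- A counting form of the error probability. -/
theorem one_sub_le_card_div {τ : Type*} [Fintype τ] {P : τ → Prop} [DecidablePred P] {N W : ℕ}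
    (hW : 0 < W) (hN : Fintype.card τ = N) (h : (Finset.univ.filter fun r => ¬ P r).card * W ≤ N)
    (hN0 : 0 < N) :
    ENNReal.ofReal (1 - 1 / (W : ℝ)) ≤ ((Finset.univ.filter fun r => P r).card : ℝ≥0∞) / N := by
  have hsum : (Finset.univ.filter fun r => P r).card + (Finset.univ.filter fun r => ¬ P r).card = N := by
    rw [Finset.card_filter_add_card_filter_not, Finset.card_univ, hN]
  generalize (Finset.univ.filter fun r => ¬ P r).card = b at h hsum
  generalize (Finset.univ.filter fun r => P r).card = c at hsum ⊢
  have hN' : (0 : ℝ) < N := by exact_mod_cast hN0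
  have hW' : (0 : ℝ) < W := by exact_mod_cast hW
  have h1 : (b : ℝ) * W ≤ N := by exact_mod_cast h
  have h2 : (c : ℝ) + b = N := by exact_mod_cast hsum
  have h3 : 1 - 1 / (W : ℝ) ≤ c / N := by
    rw [le_div_iff₀ hN', sub_mul, one_mul, one_div_mul_eq_div]
    rw [← le_div_iff₀ hW'] at h1
    linarith
  refine (ENNReal.ofReal_le_ofReal h3).trans_eq ?_
  rw [ENNReal.ofReal_div_of_pos hN', ENNReal.ofReal_natCast, ENNReal.ofReal_natCast]

end SetStream

theorem mainTheorem2 (a : ℕ) :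
    ∃ (A : SetStream.StreamAlg) (C : ℝ) (c : ℕ),
      ∀ (n m k : ℕ) (ε : ℝ), 0 < n → 0 < k → k ≤ m → 0 < ε → ε < 1 →
      ∀ S : Fin m → List (Fin n), (∀ i, (S i).Nodup) →
        A.UsesSpaceAtMost (n, m, k, ⌈1 / ε⌉₊) (SetStream.stream S)
            (C * (m / ε ^ 2) * Real.log ((m : ℝ) * n + 2) ^ c) ∧
        ENNReal.ofReal (1 - 1 / ((m : ℝ) * n) ^ a) ≤
          (A.result (n, m, k, ⌈1 / ε⌉₊) (SetStream.stream S)).toOuterMeasure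
            {out | SetStream.IsApproxSolution S k (1 - 1 / Real.exp 1 - ε) out} := by
  classical
  obtain ⟨g, hg, hgood⟩ := SetStream.exists_computable_choice (SetStream.primrecRel_tableGood a)
    (SetStream.exists_tableGood a)
  refine ⟨SetStream.tableAlg a g hg, 1027 * (a + 4) * 256, 3, ?_⟩
  intro n m k ε hn hk hkm hε0 hε S hS
  have hm : 0 < m := hk.trans_le hkm
  have hq : 0 < ⌈1 / ε⌉₊ := Nat.ceil_pos.2 (by positivity)
  have hp := hgood (n, m, k, ⌈1 / ε⌉₊)
  set G := g (n, m, k, ⌈1 / ε⌉₊) with hG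
  rcases hp with hp | ⟨-, hl, hp⟩
  · dsimp only at hp
    omega
  dsimp only at hl hp
  have hfail := hp _ (SetStream.systemOf_mem_allSystems hS)
  rw [SetStream.failureCount_systemOf a hk hkm hq] at hfail
  refine ⟨SetStream.tableAlg_usesSpaceAtMost a g hg _ _
    (SetStream.spaceBound_le a hn hm hε0 hε hl), ?_⟩
  rw [SetStream.tableAlg_result_apply, ← hG]
  have h1 := SetStream.one_sub_le_card_div (pow_pos (Nat.mul_pos hm hn) a) (by simp) hfail
    (by positivity)
  push_cast at h1 ⊢
  refine h1.trans ?_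
  gcongr with r hr
  intro hr
  refine SetStream.IsApproxSolution.mono ?_ hr
  have h2 := Real.one_sub_div_pow_le_exp_neg (n := k) (t := 1) (by exact_mod_cast hk)
  rw [Real.exp_neg, inv_eq_one_div] at h2
  have h3 : 1 / (⌈1 / ε⌉₊ : ℝ) ≤ ε := by
    rw [div_le_comm₀ (by exact_mod_cast hq) hε0]
    exact Nat.le_ceil _
  linarith
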